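/- Let $T$ be a complete first-order theory with infinite models, in a language $L$ of arbitrary size. Let $\kappa_{\mathrm{loc}}(T)$ be the least cardinal $\kappa$ such that for every set $A$ of parameters (in a model of $T$) and every local type $p$ over $A$ there is $A_0\subseteq A$ with $|A_0|<\kappa$ such that $p$ does not fork over $A_0$; put $\kappa_{\mathrm{loc}}(T)=\infty$ if there is no such cardinal. Then: 1. $\kappa_{\mathrm{loc}}(T)\in\{\aleph_0,\aleph_1,\infty\}$; 2. $\kappa_{\mathrm{loc}}(T)\in\{\aleph_0,\aleph_1\}$ if and only if $T$ is simple; 3. $\kappa_{\mathrm{loc}}(T)=\infty$ if and only if $T$ is not simple. Here the following standard notions are used, with parameters taken in elementary extensions of the model at hand. A local type over $A$, in a finite tuple $x$ of variables, is a maximal consistent set of formulas from $L_{x,\Delta}(A)$ for some finite set $\Delta$ of formulas, where $L_{x,\Delta}(A)$ consists of the formulas obtained from members of the Boolean algebra generated by $\Delta$ by substituting variables from $x$ or elements of $A$ for the free variables. A family of formulas is $k$-inconsistent if no $k$ of its members are jointly consistent. A formula $\varphi(x,b)$ divides over $B$ if for some $k<\omega$ there is a sequence $(b_i)_{i<\omega}$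 of realizations of $\mathrm{tp}(b/B)$ such that $(\varphi(x,b_i))_{i<\omega}$ is $k$-inconsistent. A set of formulas forks over $B$ if it implies a finite disjunction of formulas each of which divides over $B$. $T$ is simple if no formula $\varphi(x,y)$ has the tree property, i.e. there are no $k<\omega$ and $(a_s)_{s\in\omega^{<\omega}}$ such that $(\varphi(x,a_{s^\frown\langle i\rangle}))_{i<\omega}$ is $k$-inconsistent for every $s\in\omega^{<\omega}$, while $\{\varphi(x,a_{\eta\restriction n}): n<\omega\}$ is consistent for every $\eta\in\omega^\omega$. -/

import Mathlib

open FirstOrder FirstOrder.Language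
open scoped Cardinal

universe u v w

namespace LocalForking

variable {L : FirstOrder.Language.{u, v}}

/-- A family `φ(x, b i)`, `i : ι`, of instances of `φ(x, y)` is `k`-inconsistent in `M`:
no `k` members of the family (at `k` distinct indices) are jointly satisfiable. -/
def KInconsistent {M : Type w} [L.Structure M] {n m : ℕ} (k : ℕ)
    (φ : L.Formula (Fin n ⊕ Fin m)) {ι : Type} (b : ι → Fin m → M) : Prop :=
  ∀ s : Finset ι, s.card = k →
    ¬ ∃ x : Fin n → M, ∀ i ∈ s, φ.Realize (Sum.elim x (b i))

/-- `φ(x, y)` has the tree property in `M`, with respect to `k`: there are parameters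
`a s`, for finite sequences `s` of natural numbers, such that the instances at the immediate
successors of any node are `k`-inconsistent, while the instances along any infinite branch
are consistent (that is, finitely satisfiable). -/
def HasTreeProperty (M : Type w) [L.Structure M] {n m : ℕ} (k : ℕ)
    (φ : L.Formula (Fin n ⊕ Fin m)) : Prop :=
  ∃ a : List ℕ → Fin m → M,
    (∀ s : List ℕ, KInconsistent k φ (fun i : ℕ => a (s ++ [i]))) ∧
    ∀ (σ : ℕ → ℕ) (F : Finset ℕ), ∃ x : Fin n → M,
      ∀ l ∈ F, φ.Realize (Sum.elim x (a ((List.range l).map σ)))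

/-- A theory is simple if no formula has the tree property in a model of it. -/
def IsSimple (T : L.Theory) : Prop :=
  ∀ (M : Theory.ModelType.{u, v, w} T) (n m k : ℕ) (φ : L.Formula (Fin n ⊕ Fin m)),
    ¬ HasTreeProperty M k φ

/-- The formula `φ(x, b)`, with parameters `b` from `M`, divides over `B ⊆ M`: for some `k`
there is a sequence `c 0, c 1, …` of realizations of the type of `b` over `B`, in an elementary
extension of `M`, such that `φ(x, c 0), φ(x, c 1), …` is `k`-inconsistent. -/
def Divides {M : Type w} [L.Structure M] (B : Set M) {n m : ℕ}
    (φ : L.Formula (Fin n ⊕ Fin m)) (b : Fin m → M) : Prop :=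
  ∃ (N : Type w) (_ : L.Structure N) (g : M ↪ₑ[L] N) (k : ℕ) (c : ℕ → Fin m → N),
    (∀ (i : ℕ) (ψ : L.Formula (B ⊕ Fin m)),
      ψ.Realize (Sum.elim (fun e : B => g e) (c i)) ↔
        ψ.Realize (Sum.elim (fun e : B => (e : M)) b)) ∧
    KInconsistent k φ c

/-- Formulas in the variables `x = (x₀, …, xₙ₋₁)` with parameters from `M`: the free variables
are the `xᵢ`, and the elements of `M`, which stand for themselves. -/
abbrev ParamFormula (L : FirstOrder.Language.{u, v}) (n : ℕ) (M : Type w) : Type _ :=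
  L.Formula (Fin n ⊕ M)

/-- The tuple `x` of an extension `N` of `M` (along `f`) realizes the set `p` of formulas with
parameters from `M`. -/
def Realizes {M : Type w} {N : Type w} [L.Structure N] {n : ℕ}
    (f : M → N) (p : Set (ParamFormula L n M)) (x : Fin n → N) : Prop :=
  ∀ θ ∈ p, Formula.Realize θ (Sum.elim x f)

/-- A set of formulas with parameters from `M` is consistent (with the theory of `M` with all
its elements named): it is finitely satisfiable in `M`. -/
def Consistent {M : Type w} [L.Structure M] {n : ℕ} (p : Set (ParamFormula L n M)) : Prop :=
  ∀ F : Finset (ParamFormula L n M), (F : Set (ParamFormula L n M)) ⊆ p →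
    ∃ x : Fin n → M, Realizes id (F : Set (ParamFormula L n M)) x

/-- The set `p` of formulas over `M` forks over `B ⊆ M`: it implies a finite disjunction
`φ₀(x, b₀) ∨ … ∨ φᵣ₋₁(x, bᵣ₋₁)` of formulas, with parameters from some elementary extension `N`
of `M`, each of which divides over `B`. (Implication: every tuple realizing `p`, in any elementary
extension of `N`, satisfies the disjunction.) -/
def Forks {M : Type w} [L.Structure M] {n : ℕ} (p : Set (ParamFormula L n M))
    (B : Set M) : Prop :=
  ∃ (N : Type w) (_ : L.Structure N) (f : M ↪ₑ[L] N) (r : ℕ) (m : Fin r → ℕ)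
    (φ : ∀ j, L.Formula (Fin n ⊕ Fin (m j))) (b : ∀ j, Fin (m j) → N),
    (∀ j, Divides (f '' B) (φ j) (b j)) ∧
    ∀ (N' : Type w) [L.Structure N'] (g : N ↪ₑ[L] N') (x : Fin n → N'),
      Realizes (fun e => g (f e)) p x →
        ∃ j, (φ j).Realize (Sum.elim x (fun i => g (b j i)))

/-- The Boolean algebra of formulas generated by `Δ`. -/
inductive BoolGen {α : Type} (Δ : Finset (L.Formula α)) : L.Formula α → Prop
  | of (φ : L.Formula α) : φ ∈ Δ → BoolGen Δ φ
  | bot : BoolGen Δ ⊥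
  | not (φ : L.Formula α) : BoolGen Δ φ → BoolGen Δ φ.not
  | inf (φ ψ : L.Formula α) : BoolGen Δ φ → BoolGen Δ ψ → BoolGen Δ (φ ⊓ ψ)
  | sup (φ ψ : L.Formula α) : BoolGen Δ φ → BoolGen Δ ψ → BoolGen Δ (φ ⊔ ψ)

/-- `L_{x,Δ}(A)`: the formulas obtained from members of the Boolean algebra generated by `Δ` by
substituting variables from `x = (x₀, …, xₙ₋₁)` or elements of `A` for the free variables. -/
def DeltaFormulas {M : Type w} {k : ℕ} (Δ : Finset (L.Formula (Fin k))) (n : ℕ)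
    (A : Set M) : Set (ParamFormula L n M) :=
  {θ | ∃ (φ : L.Formula (Fin k)) (σ : Fin k → Fin n ⊕ A), BoolGen Δ φ ∧
    θ = φ.relabel (fun i => Sum.map id Subtype.val (σ i))}

/-- `p ∈ S_Δ(A)`, in the variables `x = (x₀, …, xₙ₋₁)`: a maximal consistent subset of
`L_{x,Δ}(A)`. -/
def IsDeltaType {M : Type w} [L.Structure M] {k : ℕ} (Δ : Finset (L.Formula (Fin k))) {n : ℕ}
    (A : Set M) (p : Set (ParamFormula L n M)) : Prop :=
  Maximal (fun q => q ⊆ DeltaFormulas Δ n A ∧ Consistent q) p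

/-- Every local type over a subset `A` of a model of `T` does not fork over some subset of `A`
of size `< κ`. -/
def LocalCharacter (T : L.Theory) (κ : Cardinal.{w}) : Prop :=
  ∀ (M : Theory.ModelType.{u, v, w} T) (A : Set M) (k n : ℕ) (Δ : Finset (L.Formula (Fin k)))
    (p : Set (ParamFormula L n M)), IsDeltaType Δ A p →
      ∃ B : Set M, B ⊆ A ∧ #B < κ ∧ ¬ Forks p B

open Classical in
/-- `κ_loc(T)`: the least cardinal as in `LocalCharacter`, and `∞` (that is, `⊤`) if there is
none. -/
noncomputable def kappaLoc (T : L.Theory) : WithTop Cardinal.{w} :=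
  if ∃ κ : Cardinal.{w}, LocalCharacter T κ then
    ((sInf {κ : Cardinal.{w} | LocalCharacter T κ} : Cardinal.{w}) : WithTop Cardinal.{w})
  else ⊤

end LocalForking

/-! The engine is a finitary local rank: `RankGE φ k W n X` asks for a tree of height `n` and
branching `W + 1` whose siblings are inconsistent instances and whose branches are realized in `X`.
For fixed `n` and `W` this is first order in the parameters of `X`. Hence, if `X` is defined over
`e`, `φ(x, b)` divides over `e` and `X ∩ φ(x, b)` has rank at least `n`, then conjugates of `b` over
`e` witness rank at least `n + 1` for `X`. In a simple theory ranks are bounded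
(`IsSimple.exists_not_rankGE`), so this step cannot be repeated forever.

If `T` is simple, the principle first yields realizations of a given type whose type over the model
does not divide (`IsSimple.exists_nondividing`), then shows that a formula covered by finitely many
dividing formulas divides (`IsSimple.exists_kDiv_of_cover`). Now let `p` be a local type. Up to the
choice of parameters there are only countably many conjunctions of `Δ`-formulas, whatever the size
of `L`. For each of them and each `k`, some finite part of `p` has the least rank; let `B` be the
countable set of parameters of these parts. If `p` forked over `B`, a conjunction of members of `p`
would divide over `B` and push a least rank up.

If `T` is not simple, compactness stretches a branch of the tree to any length, each instance
dividing over the earlier parameters. Beyond the indices of a small `B` there remains an instance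
that belongs to the type and divides over `B`.

No finite cardinal suffices: for `n` algebraically independent elements, the equality type saying
`xᵢ = aᵢ` forks over every proper subset of them. -/

namespace LocalForking

/-! ### Uniformly definable predicates -/

section Definability

universe ua ub uc

variable {L : FirstOrder.Language.{u, v}} {α : Type ua} {γ : Type ub} {δ : Type uc}

/-- A predicate on `γ`-indexed tuples of `L`-structures is uniformly definable if one formula
defines it in all nonempty structures. -/
def UDef (P : ∀ (M : Type w) [L.Structure M] [Nonempty M], (γ → M) → Prop) : Prop :=
  ∃ χ : L.Formula γ, ∀ (M : Type w) [L.Structure M] [Nonempty M] (d : γ → M),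
    χ.Realize d ↔ P M d

theorem UDef.congr {P Q : ∀ (M : Type w) [L.Structure M] [Nonempty M], (γ → M) → Prop}
    (hP : UDef P)
    (h : ∀ (M : Type w) [L.Structure M] [Nonempty M] (d : γ → M), P M d ↔ Q M d) : UDef Q := by
  obtain ⟨χ, hχ⟩ := hP
  exact ⟨χ, fun M _ _ d => (hχ M d).trans (h M d)⟩

theorem UDef.realize (φ : L.Formula α) (t : ∀ (M : Type w), (γ → M) → α → M) (τ : α → γ)
    (h : ∀ (M : Type w) (d : γ → M), d ∘ τ = t M d) :
    UDef (fun (M : Type w) [L.Structure M] [Nonempty M] (d : γ → M) => φ.Realize (t M d)) :=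
  ⟨φ.relabel τ, fun M _ _ d => by rw [Formula.realize_relabel, h]⟩

theorem UDef.comp {P : ∀ (M : Type w) [L.Structure M] [Nonempty M], (γ → M) → Prop}
    (hP : UDef P) (τ : γ → δ) :
    UDef (fun (M : Type w) [L.Structure M] [Nonempty M] (d : δ → M) => P M (d ∘ τ)) := by
  obtain ⟨χ, hχ⟩ := hP
  exact ⟨χ.relabel τ, fun M _ _ d => by rw [Formula.realize_relabel, hχ]⟩

theorem UDef.const (p : Prop) :
    UDef (L := L) (fun (M : Type w) [L.Structure M] [Nonempty M] (_ : γ → M) => p) := by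
  by_cases hp : p
  · exact ⟨⊤, fun M _ _ d => by simp [hp]⟩
  · exact ⟨⊥, fun M _ _ d => by simp [hp]⟩

theorem UDef.eq (i j : γ) :
    UDef (L := L) (fun (M : Type w) [L.Structure M] [Nonempty M] (d : γ → M) => d i = d j) :=
  ⟨(Term.var i).equal (Term.var j), fun M _ _ d => by simp⟩

theorem UDef.not {P : ∀ (M : Type w) [L.Structure M] [Nonempty M], (γ → M) → Prop}
    (hP : UDef P) : UDef (fun (M : Type w) [L.Structure M] [Nonempty M] (d : γ → M) => ¬ P M d) := by
  obtain ⟨χ, hχ⟩ := hP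
  exact ⟨χ.not, fun M _ _ d => by rw [Formula.realize_not, hχ]⟩

theorem UDef.and {P Q : ∀ (M : Type w) [L.Structure M] [Nonempty M], (γ → M) → Prop}
    (hP : UDef P) (hQ : UDef Q) :
    UDef (fun (M : Type w) [L.Structure M] [Nonempty M] (d : γ → M) => P M d ∧ Q M d) := by
  obtain ⟨χ, hχ⟩ := hP
  obtain ⟨ρ, hρ⟩ := hQ
  exact ⟨χ ⊓ ρ, fun M _ _ d => by rw [Formula.realize_inf, hχ, hρ]⟩

theorem UDef.imp {P Q : ∀ (M : Type w) [L.Structure M] [Nonempty M], (γ → M) → Prop}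
    (hP : UDef P) (hQ : UDef Q) :
    UDef (fun (M : Type w) [L.Structure M] [Nonempty M] (d : γ → M) => P M d → Q M d) := by
  obtain ⟨χ, hχ⟩ := hP
  obtain ⟨ρ, hρ⟩ := hQ
  exact ⟨χ.imp ρ, fun M _ _ d => by rw [Formula.realize_imp, hχ, hρ]⟩

theorem UDef.imp_const {p : Prop}
    {P : ∀ (M : Type w) [L.Structure M] [Nonempty M], (γ → M) → Prop} (hP : p → UDef P) :
    UDef (fun (M : Type w) [L.Structure M] [Nonempty M] (d : γ → M) => p → P M d) := by
  by_cases hp : p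
  · exact (hP hp).congr fun M _ _ d => by simp [hp]
  · exact (UDef.const True).congr fun M _ _ d => by simp [hp]

theorem UDef.finite_forall {ι : Type*} [Finite ι]
    {P : ι → ∀ (M : Type w) [L.Structure M] [Nonempty M], (γ → M) → Prop} (hP : ∀ i, UDef (P i)) :
    UDef (fun (M : Type w) [L.Structure M] [Nonempty M] (d : γ → M) => ∀ i, P i M d) := by
  choose χ hχ using hP
  exact ⟨Formula.iInf χ, fun M _ _ d => by
    rw [Formula.realize_iInf]; exact forall_congr' fun i => hχ i M d⟩

theorem UDef.finset_forall {ι : Type*} (s : Finset ι)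
    {P : ι → ∀ (M : Type w) [L.Structure M] [Nonempty M], (γ → M) → Prop}
    (hP : ∀ i, UDef (P i)) :
    UDef (fun (M : Type w) [L.Structure M] [Nonempty M] (d : γ → M) => ∀ i ∈ s, P i M d) :=
  (UDef.finite_forall (ι := s) fun i => hP i).congr fun M _ _ d => by simp

theorem UDef.finite_exists {ι : Type*} [Finite ι]
    {P : ι → ∀ (M : Type w) [L.Structure M] [Nonempty M], (γ → M) → Prop} (hP : ∀ i, UDef (P i)) :
    UDef (fun (M : Type w) [L.Structure M] [Nonempty M] (d : γ → M) => ∃ i, P i M d) := by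
  choose χ hχ using hP
  exact ⟨Formula.iSup χ, fun M _ _ d => by
    rw [Formula.realize_iSup]; exact exists_congr fun i => hχ i M d⟩

/-- Uniform definability is preserved by quantification over tuples of arbitrary length: only
finitely many of the variables occur in a formula. -/
theorem UDef.exists_tuple
    {P : ∀ (M : Type w) [L.Structure M] [Nonempty M], (γ → M) → (δ → M) → Prop}
    (hP : UDef (fun (M : Type w) [L.Structure M] [Nonempty M] (d : γ ⊕ δ → M) =>
      P M (d ∘ Sum.inl) (d ∘ Sum.inr))) :
    UDef (fun (M : Type w) [L.Structure M] [Nonempty M] (d : γ → M) => ∃ y, P M d y) := by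
  classical
  obtain ⟨χ, hχ⟩ := hP
  let D := {d : δ // Sum.inr d ∈ χ.freeVarFinset}
  have : Finite D := Finite.of_injective
    (fun d : D => (⟨Sum.inr d.1, d.2⟩ : χ.freeVarFinset)) fun a b h => by
      have h' : (Sum.inr a.1 : γ ⊕ δ) = Sum.inr b.1 := congrArg Subtype.val h
      exact Subtype.ext (Sum.inr_injective h')
  let f : χ.freeVarFinset → γ ⊕ D := fun a =>
    match a with
    | ⟨Sum.inl c, _⟩ => Sum.inl c
    | ⟨Sum.inr d, h⟩ => Sum.inr ⟨d, h⟩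
  refine ⟨Formula.iExs D (BoundedFormula.restrictFreeVar χ f), fun M _ _ d => ?_⟩
  rw [Formula.realize_iExs]
  have key : ∀ y : δ → M,
      Formula.Realize (BoundedFormula.restrictFreeVar χ f) (Sum.elim d fun e : D => y e.1) ↔
        P M d y := by
    intro y
    rw [Formula.Realize, BoundedFormula.realize_restrictFreeVar (Sum.elim d y)]
    · exact hχ M (Sum.elim d y)
    · rintro ⟨c | e, h⟩ <;> rfl
  constructor
  · rintro ⟨y, hy⟩
    -- Variables that do not occur in `χ` receive an arbitrary value; here nonemptiness is needed.
    let y' : δ → M := fun e =>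
      if h : Sum.inr e ∈ χ.freeVarFinset then y ⟨e, h⟩ else Classical.arbitrary M
    refine ⟨y', (key y').1 ?_⟩
    have : (fun e : D => y' e.1) = y := by
      funext e
      exact dif_pos e.2
    rwa [this]
  · rintro ⟨y, hy⟩
    exact ⟨_, (key y).2 hy⟩

theorem UDef.exists_family {ι : Type*}
    {P : ∀ (M : Type w) [L.Structure M] [Nonempty M], (γ → M) → (ι → δ → M) → Prop}
    (hP : UDef (fun (M : Type w) [L.Structure M] [Nonempty M] (d : γ ⊕ (ι × δ) → M) =>
      P M (d ∘ Sum.inl) (fun i y => d (Sum.inr (i, y))))) :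
    UDef (fun (M : Type w) [L.Structure M] [Nonempty M] (d : γ → M) => ∃ y, P M d y) := by
  refine (UDef.exists_tuple (δ := ι × δ)
    (P := fun (M : Type w) _ _ d y => P M d fun i e => y (i, e)) hP).congr fun M _ _ d => ?_
  exact ⟨fun ⟨y, hy⟩ => ⟨_, hy⟩, fun ⟨y, hy⟩ => ⟨fun q => y q.1 q.2, hy⟩⟩

/-- Uniformly definable predicates are preserved and reflected by elementary embeddings. -/
theorem UDef.map_iff {P : ∀ (M : Type w) [L.Structure M] [Nonempty M], (γ → M) → Prop}
    (hP : UDef P) {M N : Type w} [L.Structure M] [L.Structure N] [Nonempty M] [Nonempty N]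
    (g : M ↪ₑ[L] N) (d : γ → M) : P N (g ∘ d) ↔ P M d := by
  obtain ⟨χ, hχ⟩ := hP
  rw [← hχ, ← hχ, g.map_formula]

end Definability

/-! ### Compactness over a given model -/

section Compactness

universe ua

variable {L : FirstOrder.Language.{u, v}} {α : Type ua}

/-- **Compactness**: a set of formulas with parameters in `M` which is finitely satisfiable in `M`
is satisfiable in an elementary extension of `M`. -/
theorem exists_elementary_realize {M : Type w} [L.Structure M] [Nonempty M]
    (S : Set (L.Formula (α ⊕ M)))
    (h : ∀ F : Finset (L.Formula (α ⊕ M)), (F : Set (L.Formula (α ⊕ M))) ⊆ S →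
      ∃ v : α → M, ∀ θ ∈ F, θ.Realize (Sum.elim v id)) :
    ∃ (N : Type max u v w ua) (_ : L.Structure N) (_ : Nonempty N) (g : M ↪ₑ[L] N) (v : α → N),
      ∀ θ ∈ S, θ.Realize (Sum.elim v g) := by
  classical
  have h' : ∀ F : Finset S, ∃ v : α → M, ∀ θ ∈ F, θ.1.Realize (Sum.elim v id) := by
    intro F
    obtain ⟨v, hv⟩ := h (F.image Subtype.val) (by
      intro θ hθ
      simp only [Finset.coe_image, Set.mem_image] at hθ
      obtain ⟨θ', -, rfl⟩ := hθ
      exact θ'.2)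
    exact ⟨v, fun θ hθ => hv _ (Finset.mem_image_of_mem _ hθ)⟩
  choose v hv using h'
  -- Since `U` refines `atTop`, each `θ ∈ S` lies in almost every `F`; by Łoś the class of `F ↦ v F`
  -- realizes `S` in the ultrapower of `M`.
  let U : Ultrafilter (Finset S) := Ultrafilter.of Filter.atTop
  let N := (U : Filter (Finset S)).Product fun _ => M
  let q : (Finset S → M) → N := Quotient.mk ((U : Filter (Finset S)).productSetoid fun _ => M)
  have hreal : ∀ {β : Type (max w ua)} (φ : L.Formula β) (x : β → Finset S → M),
      (φ.Realize fun i => q (x i)) ↔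
        ∀ᶠ F in (U : Filter (Finset S)), φ.Realize fun i => x i F :=
    fun φ x => Ultraproduct.realize_formula_cast (u := U) φ x
  have hreal' : ∀ {n : ℕ} (φ : L.Formula (Fin n)) (x : Fin n → Finset S → M),
      (φ.Realize fun i => q (x i)) ↔
        ∀ᶠ F in (U : Filter (Finset S)), φ.Realize fun i => x i F :=
    fun φ x => Ultraproduct.realize_formula_cast (u := U) φ x
  let g : M ↪ₑ[L] N :=
    { toFun := fun a => q fun _ => a
      map_formula' := fun n φ x =>
        (hreal' φ fun i _ => x i).trans (by simp only [Filter.eventually_const]) }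
  refine ⟨N, inferInstance, inferInstance, g, fun i => q fun F => v F i,
    fun θ hθ => ?_⟩
  have e : (Sum.elim (fun i => q fun F => v F i) g) =
      fun i : α ⊕ M => q (Sum.elim (fun i F => v F i) (fun a _ => a) i) := by
    funext i
    rcases i with i | i <;> rfl
  rw [e]
  refine (hreal θ (Sum.elim (fun i F => v F i) fun a _ => a)).2 ?_
  have hle : (U : Filter (Finset S)) ≤ Filter.atTop := Ultrafilter.of_le _
  refine hle (Filter.mem_of_superset (Filter.mem_atTop {(⟨θ, hθ⟩ : S)}) fun F hF => ?_)
  have hr := hv F ⟨θ, hθ⟩ (hF (Finset.mem_singleton_self _))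
  have e' : Sum.elim (v F) id =
      fun i : α ⊕ M => Sum.elim (fun i F => v F i) (fun a (_ : Finset S) => a) i F := by
    funext i
    rcases i with i | i <;> rfl
  rw [e'] at hr
  exact hr

end Compactness

section Compactness

universe ua ub

variable {L : FirstOrder.Language.{u, v}} {α : Type ua} {δ : Type ub}

/-- Compactness for families of uniformly definable conditions. -/
theorem exists_elementary_of_uDef {ι : Type*}
    {P : ι → ∀ (M : Type max u v w ua) [L.Structure M] [Nonempty M], (α → M) → (δ → M) → Prop}
    (hP : ∀ i, UDef (fun (M : Type max u v w ua) [L.Structure M] [Nonempty M] (d : α ⊕ δ → M) =>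
      P i M (d ∘ Sum.inl) (d ∘ Sum.inr)))
    {M : Type max u v w ua} [L.Structure M] [Nonempty M] (e : δ → M)
    (h : ∀ F : Finset ι, ∃ x : α → M, ∀ i ∈ F, P i M x e) :
    ∃ (N : Type max u v w ua) (_ : L.Structure N) (_ : Nonempty N) (g : M ↪ₑ[L] N) (x : α → N),
      ∀ i, P i N x (g ∘ e) := by
  classical
  choose χ hχ using hP
  let f : ι → L.Formula (α ⊕ M) := fun i => (χ i).relabel (Sum.map id e)
  have hf : ∀ i (N : Type max u v w ua) [L.Structure N] [Nonempty N] (x : α → N) (g : M → N),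
      (f i).Realize (Sum.elim x g) ↔ P i N x (g ∘ e) := by
    intro i N _ _ x g
    rw [Formula.realize_relabel]
    have : Sum.elim x g ∘ Sum.map id e = Sum.elim x (g ∘ e) := by
      funext j
      rcases j with j | j <;> rfl
    rw [this]
    exact hχ i N _
  obtain ⟨N, i1, i2, g, x, hx⟩ :=
    exists_elementary_realize.{u, v, max u v w ua, ua} (M := M) (Set.range f) (by
      intro F hF
      obtain ⟨G, hG⟩ : ∃ G : Finset ι, F ⊆ G.image f := by
        obtain ⟨G, -, hG⟩ := Finset.subset_set_image_iff.1 (Set.image_univ (f := f) ▸ hF)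
        exact ⟨G, hG.symm.subset⟩
      obtain ⟨x, hx⟩ := h G
      refine ⟨x, fun θ hθ => ?_⟩
      obtain ⟨i, hi, rfl⟩ := Finset.mem_image.1 (hG hθ)
      exact (hf i M x id).2 (hx i hi))
  exact ⟨N, i1, i2, g, x, fun i => (hf i N x g).1 (hx _ ⟨i, rfl⟩)⟩

end Compactness

/-! ### Dividing in finitary form -/

section Dividing

universe ua ub uc ud

variable {L : FirstOrder.Language.{u, v}} {α : Type ua} {β : Type ub} {γ : Type uc} {δ : Type ud}

/-- `KInconsistent` for formulas in arbitrary tuples of variables. -/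
def KIncons {M : Type w} [L.Structure M] (k : ℕ) (φ : L.Formula (α ⊕ β)) {ι : Type}
    (b : ι → β → M) : Prop :=
  ∀ s : Finset ι, s.card = k → ¬ ∃ x : α → M, ∀ i ∈ s, φ.Realize (Sum.elim x (b i))

theorem KIncons.comp {M : Type w} [L.Structure M] {k : ℕ} {φ : L.Formula (α ⊕ β)} {ι κ : Type}
    {b : ι → β → M} (h : KIncons k φ b) (f : κ ↪ ι) : KIncons k φ (fun i => b (f i)) := by
  rintro s hs ⟨x, hx⟩
  refine h (s.map f) (by simpa using hs) ⟨x, fun i hi => ?_⟩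
  obtain ⟨j, hj, rfl⟩ := Finset.mem_map.1 hi
  exact hx j hj

theorem KIncons.of_fin {M : Type w} [L.Structure M] {k : ℕ} {φ : L.Formula (α ⊕ β)}
    {b : ℕ → β → M} (h : ∀ W, KIncons k φ fun i : Fin W => b i) : KIncons k φ b := by
  rintro s hs ⟨x, hx⟩
  have hlt : ∀ i ∈ s, i < s.sup id + 1 := fun i hi =>
    Nat.lt_succ_of_le (Finset.le_sup (f := id) hi)
  refine h (s.sup id + 1) (s.attachFin hlt) (by simpa using hs) ⟨x, fun i hi => hx i ?_⟩
  exact (Finset.mem_attachFin hlt).1 hi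

theorem uDef_kIncons {ι : Type} [Finite ι] (k : ℕ) (φ : L.Formula (α ⊕ β))
    (t : ∀ (M : Type w), (γ → M) → ι → β → M) (τ : ι → β → γ)
    (h : ∀ (M : Type w) (d : γ → M) i y, t M d i y = d (τ i y)) :
    UDef (fun (M : Type w) [L.Structure M] [Nonempty M] (d : γ → M) => KIncons k φ (t M d)) := by
  refine UDef.finite_forall fun s => UDef.imp_const fun _ => UDef.not ?_
  refine UDef.exists_tuple
    (P := fun (M : Type w) _ _ d x => ∀ i ∈ s, φ.Realize (Sum.elim x (t M d i))) ?_
  refine UDef.finset_forall s fun i => ?_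
  refine UDef.realize φ (fun M d => Sum.elim (d ∘ Sum.inr) (t M (d ∘ Sum.inl) i))
    (Sum.elim Sum.inr fun y => Sum.inl (τ i y)) fun M d => ?_
  funext j
  rcases j with j | j
  · rfl
  · simp [h]

/-- `φ(x, b)` divides with respect to `k` over the tuple `e`. This is the finitary form, which
does not need elementary extensions. -/
def KDiv {M : Type w} [L.Structure M] (k : ℕ) (e : δ → M) (φ : L.Formula (α ⊕ β))
    (b : β → M) : Prop :=
  ∀ ψ : L.Formula (δ ⊕ β), ψ.Realize (Sum.elim e b) → ∀ W : ℕ,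
    ∃ c : Fin W → β → M, (∀ i, ψ.Realize (Sum.elim e (c i))) ∧ KIncons k φ c

/-- Makes each instance of `KDiv` a first-order condition on `e`, so that it can be moved along
elementary embeddings and used inside other formulas. -/
theorem uDef_exists_kIncons (k W : ℕ) (φ : L.Formula (α ⊕ β)) (ψ : L.Formula (δ ⊕ β)) :
    UDef (fun (M : Type w) [L.Structure M] [Nonempty M] (e : δ → M) =>
      ∃ c : Fin W → β → M, (∀ i, ψ.Realize (Sum.elim e (c i))) ∧ KIncons k φ c) := by
  refine UDef.exists_family (P := fun (M : Type w) _ _ e c =>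
    (∀ i, ψ.Realize (Sum.elim e (c i))) ∧ KIncons k φ c) (UDef.and ?_ ?_)
  · refine UDef.finite_forall fun i => ?_
    refine UDef.realize ψ
      (fun M d => Sum.elim (d ∘ Sum.inl) (fun y => d (Sum.inr (i, y))))
      (Sum.elim Sum.inl fun y => Sum.inr (i, y)) fun M d => ?_
    funext j
    rcases j with j | j <;> rfl
  · exact uDef_kIncons k φ (fun M d i y => d (Sum.inr (i, y))) (fun i y => Sum.inr (i, y))
      fun _ _ _ _ => rfl

variable {M N : Type w} [L.Structure M] [L.Structure N]

theorem KDiv.mono {γ : Type uc} {k : ℕ} {e : δ → M} {φ : L.Formula (α ⊕ β)} {b : β → M}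
    (h : KDiv k e φ b) (e' : γ → M) (he : ∀ i, ∃ j, e' i = e j) : KDiv k e' φ b := by
  intro ψ hψ W
  choose f hf using he
  have key : ∀ c : β → M,
      (ψ.relabel (Sum.map f id)).Realize (Sum.elim e c) ↔ ψ.Realize (Sum.elim e' c) := by
    intro c
    rw [Formula.realize_relabel]
    have : Sum.elim e c ∘ Sum.map f id = Sum.elim e' c := by
      funext j
      rcases j with j | j
      · exact (hf j).symm
      · rfl
    rw [this]
  obtain ⟨c, hc, hk⟩ := h (ψ.relabel (Sum.map f id)) ((key b).2 hψ) W
  exact ⟨c, fun i => (key _).1 (hc i), hk⟩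

theorem KDiv.congr_type {k : ℕ} {e : δ → M} {φ : L.Formula (α ⊕ β)} {b b' : β → M}
    (h : KDiv k e φ b)
    (hb : ∀ ψ : L.Formula (δ ⊕ β), ψ.Realize (Sum.elim e b') → ψ.Realize (Sum.elim e b)) :
    KDiv k e φ b' :=
  fun ψ hψ W => h ψ (hb ψ hψ) W

theorem kDiv_map_iff [Nonempty M] [Nonempty N] (g : M ↪ₑ[L] N) {k : ℕ} {e : δ → M}
    {φ : L.Formula (α ⊕ β)} {b : β → M} : KDiv k (g ∘ e) φ (g ∘ b) ↔ KDiv k e φ b := by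
  refine forall_congr' fun ψ => ?_
  rw [← Sum.comp_elim, g.map_formula]
  exact forall_congr' fun _ => forall_congr' fun W =>
    (uDef_exists_kIncons.{u, v, w} k W φ ψ).map_iff g e

theorem kIncons_relabel_iff {k : ℕ} {φ : L.Formula (α ⊕ β)} {ι : Type} {f : β → γ}
    {c : ι → γ → M} :
    KIncons k (φ.relabel (Sum.map id f)) c ↔ KIncons k φ fun i => c i ∘ f := by
  have : ∀ (x : α → M) i, (φ.relabel (Sum.map id f)).Realize (Sum.elim x (c i)) ↔
      φ.Realize (Sum.elim x (c i ∘ f)) := by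
    intro x i
    rw [Formula.realize_relabel]
    have : Sum.elim x (c i) ∘ Sum.map id f = Sum.elim x (c i ∘ f) := by
      funext j
      rcases j with j | j <;> rfl
    rw [this]
  simp only [KIncons, this]

theorem KDiv.of_relabel {k : ℕ} {e : δ → M} {φ : L.Formula (α ⊕ β)} {f : β → γ}
    {b : γ → M} (h : KDiv k e (φ.relabel (Sum.map id f)) b) : KDiv k e φ (b ∘ f) := by
  intro ψ hψ W
  have key : ∀ c : γ → M, (ψ.relabel (Sum.map id f)).Realize (Sum.elim e c) ↔
      ψ.Realize (Sum.elim e (c ∘ f)) := by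
    intro c
    rw [Formula.realize_relabel]
    have : Sum.elim e c ∘ Sum.map id f = Sum.elim e (c ∘ f) := by
      funext j
      rcases j with j | j <;> rfl
    rw [this]
  obtain ⟨c, hc, hk⟩ := h _ ((key b).2 hψ) W
  exact ⟨fun i => c i ∘ f, fun i => (key _).1 (hc i), kIncons_relabel_iff.1 hk⟩

/-- A condition `ψ` on the long tuple is projected to the subtuple indexed by `β`: some `y`
satisfies `ψ` and restricts to the given values. Finiteness of `β` makes this restriction a single
formula. -/
theorem KDiv.relabel [Nonempty M] [Finite β] {k : ℕ} {e : δ → M} {φ : L.Formula (α ⊕ β)}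
    {f : β → γ} {b : γ → M} (h : KDiv k e φ (b ∘ f)) :
    KDiv k e (φ.relabel (Sum.map id f)) b := by
  intro ψ hψ W
  obtain ⟨χ, hχ⟩ : UDef (fun (M : Type w) [L.Structure M] [Nonempty M] (d : δ ⊕ β → M) =>
      ∃ y : γ → M, ψ.Realize (Sum.elim (d ∘ Sum.inl) y) ∧ ∀ i, d (Sum.inr i) = y (f i)) := by
    refine UDef.exists_tuple (P := fun (M : Type w) _ _ d y =>
      ψ.Realize (Sum.elim (d ∘ Sum.inl) y) ∧ ∀ i, d (Sum.inr i) = y (f i)) (UDef.and ?_ ?_)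
    · refine UDef.realize ψ (fun M d => Sum.elim ((d ∘ Sum.inl) ∘ Sum.inl) (d ∘ Sum.inr))
        (Sum.elim (Sum.inl ∘ Sum.inl) Sum.inr) fun M d => ?_
      funext j
      rcases j with j | j <;> rfl
    · exact UDef.finite_forall fun i => UDef.eq (Sum.inl (Sum.inr i)) (Sum.inr (f i))
  obtain ⟨c, hc, hk⟩ := h χ ((hχ M _).2 ⟨b, hψ, fun i => rfl⟩) W
  have hc' := fun i => (hχ M _).1 (hc i)
  choose y hy hyc using hc'
  refine ⟨y, hy, kIncons_relabel_iff.2 ?_⟩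
  have : (fun i => y i ∘ f) = c := by
    funext i j
    exact (hyc i j).symm
  rwa [this]

/-- Dividing over a set is equivalent to its finitary form. -/
theorem divides_iff {n m : ℕ} {M : Type max u v w} [L.Structure M] [Nonempty M] (B : Set M)
    (φ : L.Formula (Fin n ⊕ Fin m)) (b : Fin m → M) :
    Divides B φ b ↔ ∃ k, KDiv k (Subtype.val : B → M) φ b := by
  classical
  constructor
  · rintro ⟨N, _, g, k, c, hc, hk⟩
    have : Nonempty N := Nonempty.map g inferInstance
    refine ⟨k, fun ψ hψ W => ?_⟩
    refine ((uDef_exists_kIncons.{u, v, max u v w} k W φ ψ).map_iff g Subtype.val).1 ?_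
    exact ⟨fun i => c i, fun i => (hc i ψ).2 hψ, KIncons.comp hk Fin.valEmbedding⟩
  · rintro ⟨k, hk⟩
    -- The condition indexed by `(ψ, W)` says that the first `W` terms satisfy `ψ` and are
    -- `k`-inconsistent. Finitely many conditions reduce to the conjunction of the `ψ` and the
    -- largest `W`.
    let ι := {ψ : L.Formula (B ⊕ Fin m) // ψ.Realize (Sum.elim Subtype.val b)} × ℕ
    obtain ⟨N, _, _, g, x, hx⟩ := exists_elementary_of_uDef.{u, v, w, 0, max u v w} (L := L) (ι := ι)
      (α := ℕ × Fin m) (δ := B)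
      (P := fun q M _ _ c e => (∀ i : Fin q.2, q.1.1.Realize (Sum.elim e fun y => c (i, y))) ∧
        KIncons k φ fun (i : Fin q.2) y => c (i, y)) (by
          intro q
          refine UDef.and (UDef.finite_forall fun i => ?_) ?_
          · refine UDef.realize q.1.1
              (fun M d => Sum.elim (d ∘ Sum.inr) (fun y => d (Sum.inl ((i : ℕ), y))))
              (Sum.elim Sum.inr fun y => Sum.inl ((i : ℕ), y)) fun M d => ?_
            funext j
            rcases j with j | j <;> rfl
          · exact uDef_kIncons k φ (fun M d (i : Fin q.2) y => d (Sum.inl ((i : ℕ), y)))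
              (fun i y => Sum.inl ((i : ℕ), y)) fun _ _ _ _ => rfl)
      (M := M) Subtype.val (by
        intro F
        let W := F.sup Prod.snd
        have hW : ∀ q ∈ F, q.2 ≤ W := fun q hq => Finset.le_sup (f := Prod.snd) hq
        obtain ⟨c, hc, hkc⟩ := hk (Formula.iInf fun q : F => q.1.1.1) (by
          rw [Formula.realize_iInf]
          exact fun q => q.1.1.2) W
        let x : ℕ × Fin m → M := fun q => if h : q.1 < W then c ⟨q.1, h⟩ q.2 else b q.2
        have hxc : ∀ {W'} (h : W' ≤ W) (i : Fin W'),
            (fun y => x (i, y)) = c ⟨i, i.2.trans_le h⟩ := by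
          intro W' h i
          funext y
          exact dif_pos (i.2.trans_le h)
        refine ⟨x, fun q hq => ⟨fun i => ?_, ?_⟩⟩
        · have := hc ⟨i, i.2.trans_le (hW q hq)⟩
          rw [Formula.realize_iInf] at this
          have := this ⟨q, hq⟩
          rwa [hxc (hW q hq) i]
        · have : (fun (i : Fin q.2) y => x (i, y)) = fun i => c (Fin.castLEEmb (hW q hq) i) := by
            funext i
            exact hxc (hW q hq) i
          rw [this]
          exact hkc.comp _)
    refine ⟨N, inferInstance, g, k, fun i y => x (i, y), fun i ψ => ?_, ?_⟩
    · have hpos : ∀ ψ : L.Formula (B ⊕ Fin m), ψ.Realize (Sum.elim Subtype.val b) →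
          ψ.Realize (Sum.elim (fun e : B => g e) fun y => x (i, y)) := fun ψ hψ =>
        (hx (⟨ψ, hψ⟩, i + 1)).1 ⟨i, Nat.lt_succ_self i⟩
      refine ⟨fun h => ?_, hpos ψ⟩
      -- The converse inclusion of types comes from applying the inclusion to the negation.
      by_contra hn
      exact hpos ψ.not (by rwa [Formula.realize_not]) h
    · refine KIncons.of_fin fun W => ?_
      exact (hx (⟨⊤, by simp⟩, W)).2

end Dividing

/-! ### The local rank -/

section Rank

universe ua ub uc

variable {L : FirstOrder.Language.{u, v}} {α : Type ua} {β : Type ub}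

/-- A finitary local rank: `RankGE φ k W n X` says that there is a tree of height `n`, in which
all nodes below the leaves have `W + 1` successors, the nodes being instances of the formulas
`φ j`; the successors of a node are `k j`-inconsistent instances of one `φ j`, and the instances
along a branch are jointly satisfied by an element of `X`. -/
def RankGE {M : Type w} [L.Structure M] {J : Type*} (φ : J → L.Formula (α ⊕ β)) (k : J → ℕ)
    (W : ℕ) : ℕ → Set (α → M) → Prop
  | 0, X => X.Nonempty
  | n + 1, X => ∃ (j : J) (c : Fin (W + 1) → β → M), KIncons (k j) (φ j) c ∧
      ∀ l, RankGE φ k W n (X ∩ {x | (φ j).Realize (Sum.elim x (c l))})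

variable {M : Type w} [L.Structure M] {J : Type*} {φ : J → L.Formula (α ⊕ β)} {k : J → ℕ}

theorem RankGE.mono {W n : ℕ} {X Y : Set (α → M)} (h : RankGE φ k W n X) (hXY : X ⊆ Y) :
    RankGE φ k W n Y := by
  induction n generalizing X Y with
  | zero => exact Set.Nonempty.mono hXY h
  | succ n ih =>
    obtain ⟨j, c, hc, hl⟩ := h
    exact ⟨j, c, hc, fun l => ih (hl l) (Set.inter_subset_inter_left _ hXY)⟩

theorem RankGE.mono_width {W W' n : ℕ} {X : Set (α → M)} (h : RankGE φ k W' n X) (hW : W ≤ W') :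
    RankGE φ k W n X := by
  induction n generalizing X with
  | zero => exact h
  | succ n ih =>
    obtain ⟨j, c, hc, hl⟩ := h
    exact ⟨j, _, hc.comp (Fin.castLEEmb (Nat.succ_le_succ hW)), fun l => ih (hl _)⟩

theorem RankGE.nonempty {W n : ℕ} {X : Set (α → M)} (h : RankGE φ k W n X) : X.Nonempty := by
  induction n generalizing X with
  | zero => exact h
  | succ n ih =>
    obtain ⟨j, c, -, hl⟩ := h
    exact (ih (hl 0)).mono Set.inter_subset_left

theorem RankGE.of_succ {W n : ℕ} {X : Set (α → M)} (h : RankGE φ k W (n + 1) X) :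
    RankGE φ k W n X := by
  induction n generalizing X with
  | zero => exact h.nonempty
  | succ n ih =>
    obtain ⟨j, c, hc, hl⟩ := h
    exact ⟨j, c, hc, fun l => ih (hl l)⟩

theorem RankGE.mono_height {W n n' : ℕ} {X : Set (α → M)} (h : RankGE φ k W n' X) (hn : n ≤ n') :
    RankGE φ k W n X := by
  induction n', hn using Nat.le_induction with
  | base => exact h
  | succ n' _ ih => exact ih h.of_succ

/-- The rank of a finite union is attained at one of the members. -/
theorem RankGE.exists_of_subset_iUnion {I : Type*} [Fintype I] {W n : ℕ} {X : Set (α → M)}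
    {Y : I → Set (α → M)} (h : RankGE φ k (Fintype.card I * W) n X) (hXY : X ⊆ ⋃ i, Y i) :
    ∃ i, RankGE φ k W n (X ∩ Y i) := by
  classical
  induction n generalizing X with
  | zero =>
    obtain ⟨x, hx⟩ := h
    obtain ⟨i, hi⟩ := Set.mem_iUnion.1 (hXY hx)
    exact ⟨i, x, hx, hi⟩
  | succ n ih =>
    obtain ⟨j, c, hc, hl⟩ := h
    choose i hi using fun l => ih (hl l) (Set.inter_subset_left.trans hXY)
    -- Pigeonhole: among `card I * W + 1` successors, at least `W + 1` choose the same member of the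
    -- cover.
    obtain ⟨i₀, hi₀⟩ := Fintype.exists_lt_card_fiber_of_mul_lt_card (n := W) i (by simp)
    obtain ⟨t, ht, htc⟩ := Finset.exists_subset_card_eq (Nat.succ_le_of_lt hi₀)
    let f : Fin (W + 1) ↪ Fin (Fintype.card I * W + 1) := (t.orderEmbOfFin htc).toEmbedding
    refine ⟨i₀, j, _, hc.comp f, fun l => ?_⟩
    have hfl : i (f l) = i₀ := by
      have := ht (t.orderEmbOfFin_mem htc l)
      exact (Finset.mem_filter.1 this).2
    have := hi (f l)
    rw [hfl] at this
    exact this.mono fun x hx => ⟨⟨hx.1.1, hx.2⟩, hx.1.2⟩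

/-- A tree for a finite family of formulas contains a tree for one of them. -/
theorem RankGE.exists_single [Fintype J] {W N : ℕ} {X : Set (α → M)} (n : J → ℕ)
    (hn : ∑ j, n j < N) (h : RankGE φ k W N X) :
    ∃ j, RankGE (fun _ : Unit => φ j) (fun _ => k j) W (n j) X := by
  classical
  induction N generalizing X n with
  | zero => exact absurd hn (Nat.not_lt_zero _)
  | succ N ih =>
    obtain ⟨j, c, hc, hl⟩ := h
    rcases Nat.eq_zero_or_pos (n j) with h0 | hpos
    · refine ⟨j, ?_⟩
      rw [h0]
      exact (hl 0).nonempty.mono Set.inter_subset_left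
    -- Demand one level less for the colour `j` of the root. If all successors return a `j`-tree,
    -- the root completes it; otherwise some successor already contains a tree of full height in
    -- another colour.
    · let n' : J → ℕ := Function.update n j (n j - 1)
      have hsum : ∑ j, n' j < N := by
        have h1 := Finset.sum_update_of_mem (Finset.mem_univ j) n (n j - 1)
        have h2 := Finset.add_sum_erase Finset.univ n (Finset.mem_univ j)
        rw [← Finset.sdiff_singleton_eq_erase] at h2
        change ∑ i, Function.update n j (n j - 1) i < N
        omega
      choose i hi using fun l => ih n' hsum (hl l)
      by_cases hall : ∀ l, i l = j
      · refine ⟨j, ?_⟩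
        obtain ⟨p, hp⟩ : ∃ p, n j = p + 1 := ⟨n j - 1, by omega⟩
        rw [hp]
        refine ⟨(), c, hc, fun l => ?_⟩
        have := hi l
        rw [hall l] at this
        simpa [n', hp] using this
      · push Not at hall
        obtain ⟨l, hlj⟩ := hall
        refine ⟨i l, ?_⟩
        have := hi l
        simp only [n', Function.update_of_ne hlj] at this
        exact this.mono Set.inter_subset_left

/-- With height, width and `J` all finite, the tree is described by one formula. This is what
transfers rank to conjugate parameters and between a model and its elementary extensions. -/
theorem uDef_rankGE [Finite J] (φ : J → L.Formula (α ⊕ β)) (k : J → ℕ) (W n : ℕ)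
    {γ : Type max ub uc}
    {P : ∀ (M : Type w) [L.Structure M] [Nonempty M], (γ → M) → (α → M) → Prop}
    (hP : UDef (fun (M : Type w) [L.Structure M] [Nonempty M] (d : γ ⊕ α → M) =>
      P M (d ∘ Sum.inl) (d ∘ Sum.inr))) :
    UDef (fun (M : Type w) [L.Structure M] [Nonempty M] (d : γ → M) =>
      RankGE φ k W n {x | P M d x}) := by
  induction n generalizing γ with
  | zero => exact UDef.exists_tuple hP
  | succ n ih =>
    refine UDef.finite_exists fun j => ?_
    refine UDef.exists_family (P := fun (M : Type w) _ _ d c => KIncons (k j) (φ j) c ∧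
      ∀ l, RankGE φ k W n ({x | P M d x} ∩ {x | (φ j).Realize (Sum.elim x (c l))})) (UDef.and ?_ ?_)
    · exact uDef_kIncons (k j) (φ j) (fun M d i y => d (Sum.inr (i, y)))
        (fun i y => Sum.inr (i, y)) fun _ _ _ _ => rfl
    · refine UDef.finite_forall fun l => ?_
      refine ih (P := fun (M : Type w) _ _ d x => P M (d ∘ Sum.inl) x ∧
        (φ j).Realize (Sum.elim x fun y => d (Sum.inr (l, y)))) (UDef.and ?_ ?_)
      · exact hP.comp (Sum.map Sum.inl id)
      · refine UDef.realize (φ j)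
          (fun M d => Sum.elim (d ∘ Sum.inr) (fun y => d (Sum.inl (Sum.inr (l, y)))))
          (Sum.elim Sum.inr fun y => Sum.inl (Sum.inr (l, y))) fun M d => ?_
        funext j
        rcases j with j | j <;> rfl

/-- A formula in arbitrary tuples of variables is equivalent to one in finite tuples. -/
theorem exists_fin_formula (φ : L.Formula (α ⊕ β)) :
    ∃ (n m : ℕ) (φ' : L.Formula (Fin n ⊕ Fin m)) (f : Fin n → α) (h : Fin m → β),
      Function.Injective f ∧ ∀ (M : Type w) [L.Structure M] (x : α → M) (y : β → M),
        φ'.Realize (Sum.elim (x ∘ f) (y ∘ h)) ↔ φ.Realize (Sum.elim x y) := by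
  classical
  obtain ⟨n, ⟨e⟩⟩ := Finite.exists_equiv_fin (Finset.toLeft (BoundedFormula.freeVarFinset φ))
  obtain ⟨m, ⟨e'⟩⟩ := Finite.exists_equiv_fin (Finset.toRight (BoundedFormula.freeVarFinset φ))
  let r : BoundedFormula.freeVarFinset φ → Fin n ⊕ Fin m := fun a =>
    match a with
    | ⟨Sum.inl a, h⟩ => Sum.inl (e ⟨a, Finset.mem_toLeft.2 h⟩)
    | ⟨Sum.inr b, h⟩ => Sum.inr (e' ⟨b, Finset.mem_toRight.2 h⟩)
  refine ⟨n, m, BoundedFormula.restrictFreeVar φ r, fun i => (e.symm i).1, fun i => (e'.symm i).1,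
    Subtype.val_injective.comp e.symm.injective, fun M _ x y => ?_⟩
  refine BoundedFormula.realize_restrictFreeVar (Sum.elim x y) ?_
  rintro ⟨a | b, h⟩ <;> simp [r]

/-- Reduces ranks in arbitrary tuples to finite ones, for which the tree property is stated.
Injectivity of `f` lets a joint solution in the short tuple extend to the long one, so inconsistency
survives. -/
theorem RankGE.image [Nonempty M] {α' β' : Type*} {φ : L.Formula (α ⊕ β)}
    {φ' : L.Formula (α' ⊕ β')} {f : α' → α} {h : β' → β} (hf : Function.Injective f)
    (hφ : ∀ (x : α → M) (y : β → M),
      φ'.Realize (Sum.elim (x ∘ f) (y ∘ h)) ↔ φ.Realize (Sum.elim x y))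
    {k W n : ℕ} {X : Set (α → M)}
    (hX : RankGE (fun _ : Unit => φ) (fun _ => k) W n X) :
    RankGE (fun _ : Unit => φ') (fun _ => k) W n ((fun x => x ∘ f) '' X) := by
  induction n generalizing X with
  | zero => exact Set.Nonempty.image _ hX
  | succ n ih =>
    obtain ⟨_, c, hc, hl⟩ := hX
    refine ⟨(), fun l => c l ∘ h, ?_, fun l => (ih (hl l)).mono ?_⟩
    · rintro s hs ⟨x, hx⟩
      refine hc s hs ⟨Function.extend f x fun _ => Classical.arbitrary M, fun i hi => ?_⟩
      rw [← hφ, Function.extend_comp hf]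
      exact hx i hi
    · rintro _ ⟨x, hx, rfl⟩
      exact ⟨⟨x, hx.1, rfl⟩, (hφ _ _).2 hx.2⟩

end Rank

/-! ### From unbounded rank to the tree property -/

section TreeProperty

universe ua ub

variable {L : FirstOrder.Language.{u, v}} {α : Type ua} {β : Type ub}

/-- A finite tree of instances of a formula witnessing `RankGE`, indexed by sequences. -/
theorem RankGE.exists_tree {M : Type w} [L.Structure M] [Nonempty M] {φ : L.Formula (α ⊕ β)}
    {k W n : ℕ} {X : Set (α → M)} (h : RankGE (fun _ : Unit => φ) (fun _ => k) W n X) :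
    ∃ a : List ℕ → β → M,
      (∀ s : List ℕ, s.length < n → (∀ i ∈ s, i ≤ W) →
        KIncons k φ fun i : Fin (W + 1) => a (s ++ [(i : ℕ)])) ∧
      ∀ s : List ℕ, s.length = n → (∀ i ∈ s, i ≤ W) →
        ∃ x ∈ X, ∀ t : List ℕ, t ≠ [] → t <+: s → φ.Realize (Sum.elim x (a t)) := by
  induction n generalizing X with
  | zero =>
    refine ⟨fun _ _ => Classical.arbitrary M, fun s hs => absurd hs (Nat.not_lt_zero _),
      fun s hs _ => ?_⟩
    obtain ⟨x, hx⟩ := h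
    refine ⟨x, hx, fun t ht hts => absurd (List.prefix_nil.1 ?_) ht⟩
    rwa [List.length_eq_zero_iff.1 hs] at hts
  | succ n ih =>
    obtain ⟨_, c, hc, hl⟩ := h
    choose a ha hb using fun l => ih (hl l)
    let A : List ℕ → β → M := fun s =>
      match s with
      | [] => fun _ => Classical.arbitrary M
      | i :: t => if t = [] then c (Fin.ofNat (W + 1) i) else a (Fin.ofNat (W + 1) i) t
    have hA1 : ∀ i, A [i] = c (Fin.ofNat (W + 1) i) := fun i => if_pos rfl
    have hA2 : ∀ i t, t ≠ [] → A (i :: t) = a (Fin.ofNat (W + 1) i) t := fun i t ht => if_neg ht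
    refine ⟨A, fun s hs hsW => ?_, fun s hs hsW => ?_⟩
    · rcases s with _ | ⟨i, s⟩
      · have : (fun i : Fin (W + 1) => A ([] ++ [(i : ℕ)])) = c := by
          funext i
          rw [List.nil_append, hA1]
          congr 1
          exact Fin.ofNat_val_eq_self i
        rw [this]
        exact hc
      · have : (fun j : Fin (W + 1) => A (i :: s ++ [(j : ℕ)])) =
            fun j : Fin (W + 1) => a (Fin.ofNat (W + 1) i) (s ++ [(j : ℕ)]) := by
          funext j
          rw [List.cons_append, hA2 _ _ (by simp)]
        rw [this]
        exact ha _ s (Nat.lt_of_succ_lt_succ hs) fun j hj => hsW j (List.mem_cons_of_mem _ hj)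
    · rcases s with _ | ⟨i, s⟩
      · simp at hs
      · obtain ⟨x, hx, hxt⟩ := hb (Fin.ofNat (W + 1) i) s (Nat.succ_injective hs)
          fun j hj => hsW j (List.mem_cons_of_mem _ hj)
        refine ⟨x, hx.1, fun t ht hts => ?_⟩
        rcases t with _ | ⟨j, t⟩
        · exact absurd rfl ht
        · obtain ⟨rfl, hts'⟩ := List.cons_prefix_cons.1 hts
          by_cases htn : t = []
          · subst htn
            rw [hA1]
            exact hx.2
          · rw [hA2 _ _ htn]
            exact hxt t htn hts'

/-- Compactness: each condition in the tree property involves finitely many nodes, all found in a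
finite tree that is high and wide enough. -/
theorem hasTreeProperty_of_rankGE {M : Type max u v w} [L.Structure M] [Nonempty M] {n m : ℕ}
    {φ : L.Formula (Fin n ⊕ Fin m)} {k : ℕ}
    (h : ∀ W N, RankGE (fun _ : Unit => φ) (fun _ => k) W N (Set.univ : Set (Fin n → M))) :
    ∃ (N : Type max u v w) (_ : L.Structure N) (_ : Nonempty N) (_ : M ↪ₑ[L] N),
      HasTreeProperty N k φ := by
  classical
  let ι := (List ℕ × Finset ℕ) ⊕ ((ℕ → ℕ) × Finset ℕ)
  let P : ι → ∀ (M : Type max u v w) [L.Structure M] [Nonempty M],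
      (List ℕ × Fin m → M) → (Empty → M) → Prop := fun q M _ _ a _ =>
    match q with
    | Sum.inl (s, t) => t.card = k →
        ¬ ∃ x : Fin n → M, ∀ i ∈ t, φ.Realize (Sum.elim x fun y => a (s ++ [i], y))
    | Sum.inr (σ, F) => ∃ x : Fin n → M,
        ∀ l ∈ F, φ.Realize (Sum.elim x fun y => a ((List.range l).map σ, y))
  have hP : ∀ q, UDef (fun (M : Type max u v w) [L.Structure M] [Nonempty M]
      (d : (List ℕ × Fin m) ⊕ Empty → M) => P q M (d ∘ Sum.inl) (d ∘ Sum.inr)) := by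
    have aux : ∀ (t : Finset ℕ) (f : ℕ → List ℕ),
        UDef (fun (M : Type max u v w) [L.Structure M] [Nonempty M]
          (d : (List ℕ × Fin m) ⊕ Empty → M) => ∃ x : Fin n → M,
            ∀ i ∈ t, φ.Realize (Sum.elim x fun y => d (Sum.inl (f i, y)))) := by
      intro t f
      refine UDef.exists_tuple (P := fun (M : Type max u v w) _ _ d x =>
        ∀ i ∈ t, φ.Realize (Sum.elim x fun y => d (Sum.inl (f i, y)))) ?_
      refine UDef.finset_forall t fun i => ?_
      refine UDef.realize φ
        (fun M d => Sum.elim (d ∘ Sum.inr) (fun y => d (Sum.inl (Sum.inl (f i, y)))))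
        (Sum.elim Sum.inr fun y => Sum.inl (Sum.inl (f i, y))) fun M d => ?_
      funext j
      rcases j with j | j <;> rfl
    rintro (⟨s, t⟩ | ⟨σ, F⟩)
    · exact UDef.imp_const fun _ => (aux t fun i => s ++ [i]).not
    · exact aux F fun l => (List.range l).map σ
  -- The rank tree has no formula at its root, while the tree property wants one at the empty
  -- sequence. The subtree above the node `[0]` is used instead, whence `0 :: z.1`.
  have hbound : ∀ q : ι, ∃ b : ℕ, ∀ D ≥ b, ∀ a : List ℕ → Fin m → M,
      (∀ s : List ℕ, s.length < D → (∀ i ∈ s, i ≤ D) →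
        KIncons k φ fun i : Fin (D + 1) => a (s ++ [(i : ℕ)])) →
      (∀ s : List ℕ, s.length = D → (∀ i ∈ s, i ≤ D) →
        ∃ x ∈ (Set.univ : Set (Fin n → M)),
          ∀ t : List ℕ, t ≠ [] → t <+: s → φ.Realize (Sum.elim x (a t))) →
      P q M (fun z => a (0 :: z.1) z.2) Empty.elim := by
    rintro (⟨s, t⟩ | ⟨σ, F⟩)
    · refine ⟨s.length + 2 + s.sum + t.sup id, fun D hD a ha _ => ?_⟩
      rintro htk ⟨x, hx⟩
      have hlt : ∀ i ∈ t, i < D + 1 := fun i hi => by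
        have := Finset.le_sup (f := id) hi
        simp only [id] at this
        omega
      refine ha (0 :: s) (by simp; omega) (fun i hi => ?_) (t.attachFin hlt) (by simpa using htk)
        ⟨x, fun i hi => hx i ((Finset.mem_attachFin hlt).1 hi)⟩
      rcases List.mem_cons.1 hi with rfl | hi
      · omega
      · have := List.single_le_sum (l := s) (by simp) i hi
        omega
    · let K := F.sup id
      -- Only the first `K` values of `σ` matter; setting the rest to `0` keeps the entries of a
      -- branch of full length within the width.
      let σ' : ℕ → ℕ := fun i => if i < K then σ i else 0
      refine ⟨1 + K + ∑ i ∈ Finset.range K, σ i, fun D hD a _ hb => ?_⟩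
      obtain ⟨x, -, hx⟩ := hb (0 :: (List.range (D - 1)).map σ') (by simp; omega) (by
        intro i hi
        rcases List.mem_cons.1 hi with rfl | hi
        · omega
        · obtain ⟨j, -, rfl⟩ := List.mem_map.1 hi
          by_cases hj : j < K
          · have := Finset.single_le_sum (f := σ) (fun _ _ => Nat.zero_le _)
              (Finset.mem_range.2 hj)
            simp only [σ', hj, if_true]
            omega
          · simp [σ', hj])
      refine ⟨x, fun l hl => hx (0 :: (List.range l).map σ) (List.cons_ne_nil _ _) ?_⟩
      have hlK : l ≤ K := Finset.le_sup (f := id) hl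
      rw [List.cons_prefix_cons]
      refine ⟨rfl, ?_⟩
      have h1 : (List.range l).map σ = (List.range l).map σ' := by
        refine List.map_congr_left fun i hi => ?_
        have : i < K := (List.mem_range.1 hi).trans_le hlK
        simp [σ', this]
      have h2 : List.range l = (List.range (D - 1)).take l := by
        rw [List.take_range, Nat.min_eq_left (by omega)]
      rw [h1, h2]
      exact (List.take_prefix _ _).map σ'
  choose b hb using hbound
  obtain ⟨N, _, _, g, a, ha⟩ := exists_elementary_of_uDef.{u, v, w, 0, 0} (L := L) (P := P) hP
    (M := M) Empty.elim (by
      intro F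
      obtain ⟨a, ha1, ha2⟩ := (h (F.sup b) (F.sup b)).exists_tree
      exact ⟨fun z => a (0 :: z.1) z.2, fun q hq => hb q _ (Finset.le_sup hq) a ha1 ha2⟩)
  refine ⟨N, inferInstance, inferInstance, g, fun s y => a (s, y), fun s t ht => ?_, fun σ F => ?_⟩
  · exact ha (Sum.inl (s, t)) ht
  · exact ha (Sum.inr (σ, F))

/-- In a simple theory, local ranks are bounded. -/
theorem IsSimple.exists_not_rankGE {T : L.Theory} (hT : IsSimple.{u, v, max u v w} T)
    {M : Type max u v w} [L.Structure M] [Nonempty M] [M ⊨ T] {J : Type*} [Finite J]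
    (φ : J → L.Formula (α ⊕ β)) (k : J → ℕ) :
    ∃ W n, ¬ RankGE φ k W n (Set.univ : Set (α → M)) := by
  have := Fintype.ofFinite J
  have hsingle : ∀ j, ∃ W n,
      ¬ RankGE (fun _ : Unit => φ j) (fun _ => k j) W n (Set.univ : Set (α → M)) := by
    intro j
    by_contra! hj
    obtain ⟨n, m, φ', f, h, hf, hφ⟩ := exists_fin_formula (φ j)
    obtain ⟨N, _, _, g, hN⟩ := hasTreeProperty_of_rankGE.{u, v, w} (M := M) (φ := φ') (k := k j)
      fun W N => ((hj W N).image hf (hφ M)).mono (Set.subset_univ _)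
    have : N ⊨ T := (g.theory_model_iff T).1 inferInstance
    exact hT (Theory.ModelType.of T N) n m (k j) φ' hN
  choose W n hWn using hsingle
  -- A mixed tree higher than the sum of the individual bounds contains a forbidden tree for a
  -- single formula.
  refine ⟨∑ j, W j, ∑ j, n j + 1, fun h => ?_⟩
  obtain ⟨j, hj⟩ := h.exists_single n (Nat.lt_succ_self _)
  exact hWn j (hj.mono_width (Finset.single_le_sum (fun _ _ => Nat.zero_le _) (Finset.mem_univ j)))

end TreeProperty

/-! ### Dividing over an enlarged base -/

section Dividing

universe ua ub uc ud

variable {L : FirstOrder.Language.{u, v}} {α : Type ua} {β : Type ub} {γ : Type uc} {δ : Type ud}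
  {M : Type w} [L.Structure M]

theorem KDiv.congr_formula {k : ℕ} {e : δ → M} {φ φ' : L.Formula (α ⊕ β)} {b : β → M}
    (h : KDiv k e φ b) (hφ : ∀ (x : α → M) (c : β → M),
      φ'.Realize (Sum.elim x c) → φ.Realize (Sum.elim x c)) : KDiv k e φ' b := by
  intro ψ hψ W
  obtain ⟨c, hc, hk⟩ := h ψ hψ W
  exact ⟨c, hc, fun s hs ⟨x, hx⟩ => hk s hs ⟨x, fun i hi => hφ _ _ (hx i hi)⟩⟩

/-- The finiteness assumption of `KDiv.relabel` is removed by passing to an equivalent formula with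
finitely many parameter variables. -/
theorem kDiv_relabel_iff [Nonempty M] {k : ℕ} {e : δ → M} {φ : L.Formula (α ⊕ β)} {f : β → γ}
    {b : γ → M} : KDiv k e (φ.relabel (Sum.map id f)) b ↔ KDiv k e φ (b ∘ f) := by
  refine ⟨KDiv.of_relabel, fun h => ?_⟩
  obtain ⟨n, m, φ', i, j, -, hφ⟩ := exists_fin_formula.{u, v, w} φ
  let φ₁ : L.Formula (α ⊕ Fin m) := φ'.relabel (Sum.map i id)
  have h₁ : ∀ (x : α → M) (c : Fin m → M),
      φ₁.Realize (Sum.elim x c) ↔ φ'.Realize (Sum.elim (x ∘ i) c) := by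
    intro x c
    rw [Formula.realize_relabel, Sum.elim_comp_map]
    rfl
  have h₂ : KDiv k e (φ₁.relabel (Sum.map id j)) (b ∘ f) := by
    refine h.congr_formula fun x c hx => ?_
    rw [Formula.realize_relabel, Sum.elim_comp_map] at hx
    exact (hφ M x c).1 ((h₁ _ _).1 hx)
  have h₃ : KDiv k e (φ₁.relabel (Sum.map id (f ∘ j))) b := KDiv.relabel h₂.of_relabel
  refine h₃.congr_formula fun x c hx => ?_
  rw [Formula.realize_relabel, Sum.elim_comp_map] at hx ⊢
  exact (h₁ _ _).2 ((hφ M x (c ∘ f)).2 hx)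

variable {N : Type w} [L.Structure N]

/-- Dividing over `e` is preserved by adding to `e` a tuple `d` whose type does not divide
over `e`. -/
theorem KDiv.sumElim [Nonempty M] [Nonempty N] {k : ℕ} {e : δ → M} {φ : L.Formula (α ⊕ β)}
    {b : β → M} (h : KDiv k e φ b) (g : M ↪ₑ[L] N) (d : γ → N)
    (hd : ∀ (ψ : L.Formula (γ ⊕ M)) (k : ℕ), KDiv k e ψ id → ¬ ψ.Realize (Sum.elim d g)) :
    KDiv k (Sum.elim (g ∘ e) d) φ (g ∘ b) := by
  intro ψ hψ W
  -- Length `W + 1` rather than `W`, so that the sets of indices considered below are nonempty.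
  suffices hs : ∃ c : Fin (W + 1) → β → N,
      (∀ i, ψ.Realize (Sum.elim (Sum.elim (g ∘ e) d) (c i))) ∧ KIncons k φ c by
    obtain ⟨c, hc, hk⟩ := hs
    exact ⟨fun i => c (Fin.castSuccEmb i), fun i => hc _, hk.comp _⟩
  by_contra hno
  let τ : δ ⊕ γ → γ ⊕ (δ ⊕ β) := Sum.elim (Sum.inr ∘ Sum.inl) Sum.inl
  -- `ξ(z; e, b)` says that `ψ` holds of `b` over `e, z` but has no `k`-inconsistent sequence of
  -- length `W + 1`. It divides over `e`: `W + 1` members of a `k`-inconsistent sequence of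
  -- conjugates of `b` sharing one `z` would be such a sequence. Yet `d` would satisfy it.
  obtain ⟨ξ, hξ⟩ : UDef (fun (M : Type w) [L.Structure M] [Nonempty M] (D : γ ⊕ (δ ⊕ β) → M) =>
      ψ.Realize (Sum.elim (D ∘ τ) (D ∘ Sum.inr ∘ Sum.inr)) ∧
      ¬ ∃ c : Fin (W + 1) → β → M,
        (∀ i, ψ.Realize (Sum.elim (D ∘ τ) (c i))) ∧ KIncons k φ c) := by
    refine UDef.and ?_ ((uDef_exists_kIncons k (W + 1) φ ψ).comp τ).not
    refine UDef.realize ψ (fun M D => Sum.elim (D ∘ τ) (D ∘ Sum.inr ∘ Sum.inr))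
      (Sum.elim τ (Sum.inr ∘ Sum.inr)) fun M D => ?_
    rw [Sum.comp_elim]
  have hτ : ∀ {K : Type w} (z : γ → K) (e' : δ → K) (c : β → K),
      Sum.elim z (Sum.elim e' c) ∘ τ = Sum.elim e' z := by
    intro K z e' c
    funext j
    rcases j with j | j <;> rfl
  have hdiv : KDiv (W + 1) e ξ (Sum.elim e b) := by
    intro ρ hρ W'
    have key : ∀ c : β → M,
        (ρ.relabel (Sum.elim Sum.inl (Sum.elim Sum.inl Sum.inr))).Realize (Sum.elim e c) ↔
          ρ.Realize (Sum.elim e (Sum.elim e c)) := by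
      intro c
      rw [Formula.realize_relabel]
      have : Sum.elim e c ∘ Sum.elim Sum.inl (Sum.elim Sum.inl Sum.inr) =
          Sum.elim e (Sum.elim e c) := by
        funext j
        rcases j with j | j | j <;> rfl
      rw [this]
    obtain ⟨c, hc, hk⟩ := h _ ((key b).2 hρ) W'
    refine ⟨fun i => Sum.elim e (c i), fun i => (key _).1 (hc i), ?_⟩
    rintro s hs ⟨z, hz⟩
    have hz' := fun i hi => (hξ M _).1 (hz i hi)
    simp only [hτ] at hz'
    obtain ⟨i₀, hi₀⟩ : s.Nonempty := Finset.card_pos.1 (by omega)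
    refine (hz' i₀ hi₀).2 ⟨_, fun i => ?_, hk.comp (s.orderEmbOfFin hs).toEmbedding⟩
    exact (hz' _ (s.orderEmbOfFin_mem hs i)).1
  refine hd (ξ.relabel (Sum.map id (Sum.elim e b))) (W + 1)
    ((kDiv_relabel_iff (b := id)).2 hdiv) ?_
  rw [Formula.realize_relabel, Sum.elim_comp_map, Sum.comp_elim, Function.comp_id]
  refine (hξ N _).2 ?_
  simp only [hτ]
  exact ⟨hψ, hno⟩

end Dividing

/-! ### Nondividing extensions in simple theories -/

section Simple

universe ua

variable {L : FirstOrder.Language.{u, v}} {α : Type ua}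

/-- In a simple theory, every type over `e` has realizations whose type over the whole model does
not divide over `e`. -/
theorem IsSimple.exists_nondividing {T : L.Theory} (hT : IsSimple.{u, v, max u v w} T)
    {γ δ M : Type max u v w} [L.Structure M] [Nonempty M] [M ⊨ T] (e : δ → M) (b : γ → M) :
    ∃ (N : Type max u v w) (_ : L.Structure N) (_ : Nonempty N) (g : M ↪ₑ[L] N) (b' : γ → N),
      (∀ ψ : L.Formula (δ ⊕ γ), ψ.Realize (Sum.elim e b) → ψ.Realize (Sum.elim (g ∘ e) b')) ∧
      ∀ (ψ : L.Formula (γ ⊕ M)) (k : ℕ), KDiv k e ψ id → ¬ ψ.Realize (Sum.elim b' g) := by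
  classical
  let I₁ := {ψ : L.Formula (δ ⊕ γ) // ψ.Realize (Sum.elim e b)}
  let I₂ := {ψ : L.Formula (γ ⊕ M) // ∃ k, KDiv k e ψ id}
  let P : I₁ ⊕ I₂ → ∀ (K : Type max u v w) [L.Structure K] [Nonempty K],
      (γ → K) → (M → K) → Prop := fun q K _ _ x E =>
    match q with
    | Sum.inl ψ => ψ.1.Realize (Sum.elim (E ∘ e) x)
    | Sum.inr ψ => ¬ ψ.1.Realize (Sum.elim x E)
  obtain ⟨N, _, _, g, b', hb'⟩ := exists_elementary_of_uDef.{u, v, w, max u v w, max u v w}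
    (L := L) (P := P) (by
      rintro (ψ | ψ)
      · refine UDef.realize ψ.1 (fun M d => Sum.elim ((d ∘ Sum.inr) ∘ e) (d ∘ Sum.inl))
          (Sum.elim (Sum.inr ∘ e) Sum.inl) fun M d => ?_
        funext j
        rcases j with j | j <;> rfl
      · refine (UDef.realize ψ.1 (fun M d => Sum.elim (d ∘ Sum.inl) (d ∘ Sum.inr)) id
          fun M d => ?_).not
        funext j
        rcases j with j | j <;> rfl)
    (M := M) id (by
      intro F
      by_contra! hF
      let J := F.toRight
      choose k hk using fun j : J => j.1.2
      let φ : J → L.Formula (γ ⊕ M) := fun j => j.1.1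
      let Θ : L.Formula (δ ⊕ γ) := Formula.iInf fun ψ : F.toLeft => ψ.1.1
      have hΘ : Θ.Realize (Sum.elim e b) := by
        rw [Formula.realize_iInf]
        exact fun ψ => ψ.1.2
      have hcov : ∀ x : γ → M, Θ.Realize (Sum.elim e x) →
          ∃ j, (φ j).Realize (Sum.elim x id) := by
        intro x hx
        rw [Formula.realize_iInf] at hx
        obtain ⟨q, hq, hqx⟩ := hF x
        rcases q with ψ | ψ
        · exact absurd (hx ⟨ψ, Finset.mem_toLeft.2 hq⟩) hqx
        · exact ⟨⟨ψ, Finset.mem_toRight.2 hq⟩, not_not.1 hqx⟩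
      -- If `Θ` in the type of `b` is covered by dividing formulas, every formula of this type has
      -- unbounded rank: one `φ j` inherits the rank of `Θ' ⊓ Θ`, and dividing of `φ j` adds a
      -- level.
      have hrank : ∀ (n W : ℕ) (Θ' : L.Formula (δ ⊕ γ)), Θ'.Realize (Sum.elim e b) →
          RankGE φ k W n {x : γ → M | Θ'.Realize (Sum.elim e x)} := by
        intro n
        induction n with
        | zero => exact fun W Θ' h => ⟨b, h⟩
        | succ n ih =>
          intro W Θ' h
          obtain ⟨j, hj⟩ := (ih (Fintype.card J * W) (Θ' ⊓ Θ)
            (Formula.realize_inf.2 ⟨h, hΘ⟩)).exists_of_subset_iUnion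
            (Y := fun j => {x | (φ j).Realize (Sum.elim x id)}) (by
              intro x hx
              exact Set.mem_iUnion.2 (hcov x (Formula.realize_inf.1 hx).2))
          obtain ⟨χ, hχ⟩ := uDef_rankGE.{u, v, max u v w, max u v w, max u v w, max u v w}
            φ k W n (γ := δ ⊕ M) (P := fun K _ _ d x =>
              (Θ' ⊓ Θ).Realize (Sum.elim (d ∘ Sum.inl) x) ∧
                (φ j).Realize (Sum.elim x (d ∘ Sum.inr))) (by
              refine UDef.and ?_ ?_
              · refine UDef.realize _ (fun M d => Sum.elim (d ∘ Sum.inl ∘ Sum.inl) (d ∘ Sum.inr))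
                  (Sum.map Sum.inl id) fun M d => ?_
                funext j
                rcases j with j | j <;> rfl
              · refine UDef.realize _ (fun M d => Sum.elim (d ∘ Sum.inr) (d ∘ Sum.inl ∘ Sum.inr))
                  (Sum.elim Sum.inr (Sum.inl ∘ Sum.inr)) fun M d => ?_
                funext j
                rcases j with j | j <;> rfl)
          obtain ⟨c, hc, hkc⟩ := hk j χ ((hχ M _).2 hj) (W + 1)
          refine ⟨j, c, hkc, fun l => ((hχ M _).1 (hc l)).mono fun x hx => ⟨?_, hx.2⟩⟩
          exact (Formula.realize_inf.1 hx.1).1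
      obtain ⟨W, n, hWn⟩ := hT.exists_not_rankGE.{u, v, w} (M := M) φ k
      exact hWn ((hrank n W Θ hΘ).mono (Set.subset_univ _)))
  refine ⟨N, inferInstance, inferInstance, g, b', fun ψ hψ => hb' (Sum.inl ⟨ψ, hψ⟩),
    fun ψ k hk => hb' (Sum.inr ⟨ψ, k, hk⟩)⟩

end Simple

/-! ### Chains of dividing instances -/

section Chains

universe ua

variable {L : FirstOrder.Language.{u, v}} {α : Type ua} {β : Type w}

/-- For every tuple in the list, every `φ j` divides over `e` and the tuples that precede it. -/
def DivChain {M : Type w} [L.Structure M] {J : Type*} (φ : J → L.Formula (α ⊕ β)) (k : J → ℕ) :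
    List (β → M) → ∀ {δ : Type w}, (δ → M) → Prop
  | [], _, _ => True
  | b :: l, _, e => (∀ j, KDiv (k j) e (φ j) b) ∧ DivChain φ k l (Sum.elim e b)

variable {M N : Type w} [L.Structure M] [L.Structure N] {J : Type*}
  {φ : J → L.Formula (α ⊕ β)} {k : J → ℕ} {δ : Type w}

theorem DivChain.mono {δ' : Type w} {l : List (β → M)} {e : δ → M} (h : DivChain φ k l e)
    (e' : δ' → M) (he : ∀ i, ∃ j, e' i = e j) : DivChain φ k l e' := by
  induction l generalizing δ δ' with
  | nil => trivial
  | cons b l ih =>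
    refine ⟨fun j => (h.1 j).mono e' he, ih h.2 _ ?_⟩
    rintro (i | i)
    · obtain ⟨j, hj⟩ := he i
      exact ⟨Sum.inl j, hj⟩
    · exact ⟨Sum.inr i, rfl⟩

theorem DivChain.sublist {l l' : List (β → M)} (hl : l'.Sublist l) {e : δ → M}
    (h : DivChain φ k l e) : DivChain φ k l' e := by
  induction hl generalizing δ with
  | slnil => trivial
  | cons b _ ih => exact ih (h.2.mono e fun i => ⟨Sum.inl i, rfl⟩)
  | cons_cons b _ ih => exact ⟨h.1, ih h.2⟩

/-- Iterates `KDiv.sumElim`: a type that does not divide over `e` does not divide over a larger base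
either, so the hypothesis persists along the chain. -/
theorem DivChain.sumElim [Nonempty M] [Nonempty N] {l : List (β → M)} {e : δ → M}
    (h : DivChain φ k l e) (g : M ↪ₑ[L] N) {γ : Type w} (d : γ → N)
    (hd : ∀ (ψ : L.Formula (γ ⊕ M)) (k : ℕ), KDiv k e ψ id → ¬ ψ.Realize (Sum.elim d g)) :
    DivChain φ k (l.map fun b => g ∘ b) (Sum.elim (g ∘ e) d) := by
  induction l generalizing δ with
  | nil => trivial
  | cons b l ih =>
    refine ⟨fun j => (h.1 j).sumElim g d hd, (ih h.2 fun ψ k hk => ?_).mono _ ?_⟩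
    · exact hd ψ k (hk.mono e fun i => ⟨Sum.inl i, rfl⟩)
    · rintro ((i | i) | i)
      · exact ⟨Sum.inl (Sum.inl i), rfl⟩
      · exact ⟨Sum.inr i, rfl⟩
      · exact ⟨Sum.inl (Sum.inr i), rfl⟩

/-- The tail of the chain gives rank to `Θ` intersected with an instance at the first tuple `b`,
over `e` and `b`. This rank condition lies in the type of `b` over `e`, so dividing supplies the
successors of a new root. -/
theorem DivChain.rankGE [Nonempty M] [Finite J] {l : List (β → M)} {e : δ → M}
    (h : DivChain φ k l e) (W : ℕ) (x : α → M) (Θ : L.Formula (δ ⊕ α))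
    (hΘ : Θ.Realize (Sum.elim e x)) (hx : ∀ b ∈ l, ∃ j, (φ j).Realize (Sum.elim x b)) :
    RankGE φ k W l.length {x : α → M | Θ.Realize (Sum.elim e x)} := by
  induction l generalizing δ with
  | nil => exact ⟨x, hΘ⟩
  | cons b l ih =>
    obtain ⟨j, hj⟩ := hx b List.mem_cons_self
    let Θ' : L.Formula ((δ ⊕ β) ⊕ α) :=
      Θ.relabel (Sum.map Sum.inl id) ⊓ (φ j).relabel (Sum.elim Sum.inr (Sum.inl ∘ Sum.inr))
    have hΘ' : ∀ (c : β → M) (y : α → M), Θ'.Realize (Sum.elim (Sum.elim e c) y) ↔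
        Θ.Realize (Sum.elim e y) ∧ (φ j).Realize (Sum.elim y c) := by
      intro c y
      rw [Formula.realize_inf, Formula.realize_relabel, Formula.realize_relabel, Sum.elim_comp_map]
      have : Sum.elim (Sum.elim e c) y ∘ Sum.elim Sum.inr (Sum.inl ∘ Sum.inr) = Sum.elim y c := by
        funext i
        rcases i with i | i <;> rfl
      rw [this]
      rfl
    obtain ⟨χ, hχ⟩ := uDef_rankGE.{u, v, w, ua, w, w} φ k W l.length (γ := δ ⊕ β)
      (P := fun K _ _ d y => Θ'.Realize (Sum.elim d y))
      (UDef.realize Θ' (fun K d => Sum.elim (d ∘ Sum.inl) (d ∘ Sum.inr)) id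
        fun K d => (Sum.elim_comp_inl_inr d).symm)
    have hrank := ih h.2 Θ' ((hΘ' b x).2 ⟨hΘ, hj⟩) fun b hb => hx b (List.mem_cons_of_mem _ hb)
    obtain ⟨c, hc, hk⟩ := h.1 j χ ((hχ M _).2 hrank) (W + 1)
    refine ⟨j, c, hk, fun i => ((hχ M _).1 (hc i)).mono fun y hy => ?_⟩
    exact (hΘ' _ _).1 hy

end Chains

/-! ### Forking and dividing in simple theories -/

section Simple

universe ua

variable {L : FirstOrder.Language.{u, v}} {α : Type ua} {T : L.Theory}
  {β δ M : Type max u v w} [L.Structure M] [Nonempty M] [M ⊨ T]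

/-- The chain grows at the front: the new tuple has a nondividing type over a model containing the
old chain, so the old members still divide once it joins the base. -/
theorem IsSimple.exists_divChain (hT : IsSimple.{u, v, max u v w} T) {J : Type*}
    {φ : J → L.Formula (α ⊕ β)} {k : J → ℕ} {e : δ → M} {b : β → M}
    (hφ : ∀ j, KDiv (k j) e (φ j) b) (n : ℕ) :
    ∃ (N : Type max u v w) (_ : L.Structure N) (_ : Nonempty N) (g : M ↪ₑ[L] N)
      (l : List (β → N)), l.length = n ∧
      (∀ b' ∈ l, ∀ ψ : L.Formula (δ ⊕ β),
        ψ.Realize (Sum.elim e b) → ψ.Realize (Sum.elim (g ∘ e) b')) ∧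
      DivChain φ k l (g ∘ e) := by
  induction n with
  | zero => exact ⟨M, inferInstance, inferInstance, ElementaryEmbedding.refl L M, [], rfl,
      by simp, trivial⟩
  | succ n ih =>
    obtain ⟨N, _, _, g, l, hl, htp, hch⟩ := ih
    have : N ⊨ T := (g.theory_model_iff T).1 inferInstance
    obtain ⟨N', _, _, g', b', hb', hd⟩ :=
      hT.exists_nondividing.{u, v, w} (M := N) (g ∘ e) (g ∘ b)
    have hb : ∀ ψ : L.Formula (δ ⊕ β),
        ψ.Realize (Sum.elim e b) → ψ.Realize (Sum.elim (g' ∘ g ∘ e) b') := by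
      intro ψ hψ
      refine hb' ψ ?_
      rwa [← Sum.comp_elim, g.map_formula]
    refine ⟨N', inferInstance, inferInstance, g'.comp g, b' :: l.map (fun b => g' ∘ b), by simp [hl],
      ?_, ?_, ?_⟩
    · intro c hc ψ hψ
      rcases List.mem_cons.1 hc with rfl | hc
      · exact hb ψ hψ
      · obtain ⟨c, hcl, rfl⟩ := List.mem_map.1 hc
        have h1 := htp c hcl ψ hψ
        rw [← g'.map_formula, Sum.comp_elim] at h1
        exact h1
    · intro j
      have h1 : KDiv (k j) (g' ∘ g ∘ e) (φ j) (g' ∘ g ∘ b) :=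
        (kDiv_map_iff g').2 ((kDiv_map_iff g).2 (hφ j))
      refine h1.congr_type fun ψ hψ => ?_
      rw [← Sum.comp_elim, g'.map_formula, ← Sum.comp_elim, g.map_formula]
      by_contra hn
      have := hb ψ.not (by rwa [Formula.realize_not])
      rw [Formula.realize_not] at this
      exact this hψ
    · exact hch.sumElim g' b' hd

theorem card_le_length_filter {X : Type*} (l : List X) (p : X → Bool) (s : Finset (Fin l.length))
    (hs : ∀ i ∈ s, p (l.get i) = true) : s.card ≤ (l.filter p).length := by
  have h1 : l.filter p = ((List.finRange l.length).filter (p ∘ l.get)).map l.get := by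
    rw [← List.filter_map, List.map_get_finRange]
  rw [h1, List.length_map, ← List.toFinset_card_of_nodup ((List.nodup_finRange _).filter _)]
  exact Finset.card_le_card fun i hi => by simpa using hs i hi

/-- In a simple theory, a formula which implies a finite disjunction of formulas that divide
over `e` divides over `e`. -/
theorem IsSimple.exists_kDiv_of_cover (hT : IsSimple.{u, v, max u v w} T) {J : Type*} [Finite J]
    {φ : J → L.Formula (α ⊕ β)} {k : J → ℕ} {e : δ → M} {b : β → M}
    (hφ : ∀ j, KDiv (k j) e (φ j) b) (Θ : L.Formula (α ⊕ β))
    (hcov : ∀ x, Θ.Realize (Sum.elim x b) → ∃ j, (φ j).Realize (Sum.elim x b)) :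
    ∃ K, KDiv K e Θ b := by
  classical
  obtain ⟨W, n, hWn⟩ := hT.exists_not_rankGE.{u, v, w} (M := M) φ k
  by_contra! hno
  -- The rank bound `n` serves as inconsistency constant. If `Θ` does not `n`-divide, a long enough
  -- chain has `n` members whose instances of `Θ` share a solution `x`; each of these instances puts
  -- `x` in some `φ j`, giving rank `n`.
  have hn := hno n
  simp only [KDiv, not_forall] at hn
  obtain ⟨ψ, hψ, W', hW'⟩ := hn
  obtain ⟨N, _, _, g, l, rfl, htp, hch⟩ := hT.exists_divChain.{u, v, w} hφ W'
  have hW'' := mt ((uDef_exists_kIncons.{u, v, max u v w} n l.length Θ ψ).map_iff g e).1 hW'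
  have hinc : ¬ KIncons n Θ l.get := fun h =>
    hW'' ⟨l.get, fun i => htp _ (l.get_mem i) ψ hψ, h⟩
  simp only [KIncons, not_forall, not_not] at hinc
  obtain ⟨s, hs, x, hx⟩ := hinc
  let l' := l.filter fun b => decide (Θ.Realize (Sum.elim x b))
  have hl' : n ≤ l'.length := by
    rw [← hs]
    exact card_le_length_filter l _ s fun i hi => decide_eq_true (hx i hi)
  -- The covering of `Θ` by the `φ j` is first order in `b`, hence holds for every member of the
  -- chain.
  obtain ⟨χ, hχ⟩ : UDef (fun (K : Type max u v w) [L.Structure K] [Nonempty K] (d : δ ⊕ β → K) =>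
      ¬ ∃ x : α → K, Θ.Realize (Sum.elim x (d ∘ Sum.inr)) ∧
        ¬ ∃ j, (φ j).Realize (Sum.elim x (d ∘ Sum.inr))) := by
    have aux : ∀ ρ : L.Formula (α ⊕ β),
        UDef (fun (K : Type max u v w) [L.Structure K] [Nonempty K] (d : (δ ⊕ β) ⊕ α → K) =>
          ρ.Realize (Sum.elim (d ∘ Sum.inr) (d ∘ Sum.inl ∘ Sum.inr))) := fun ρ =>
      UDef.realize ρ (fun K d => Sum.elim (d ∘ Sum.inr) (d ∘ Sum.inl ∘ Sum.inr))
        (Sum.elim Sum.inr (Sum.inl ∘ Sum.inr)) fun K d => by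
          funext j
          rcases j with j | j <;> rfl
    refine (UDef.exists_tuple (P := fun K _ _ d x => Θ.Realize (Sum.elim x (d ∘ Sum.inr)) ∧
        ¬ ∃ j, (φ j).Realize (Sum.elim x (d ∘ Sum.inr))) (UDef.and (aux Θ) ?_)).not
    exact (UDef.finite_exists fun j => aux (φ j)).not
  have hχM : χ.Realize (Sum.elim e b) := (hχ M _).2 fun ⟨x, hx1, hx2⟩ => hx2 (hcov x hx1)
  have hrank := (hch.sublist (List.filter_sublist (p := fun b => decide (Θ.Realize (Sum.elim x b))))).rankGE
    W x ⊤ (by simp) (by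
      intro c hc
      obtain ⟨hc, hΘ⟩ := List.mem_filter.1 hc
      by_contra hj
      exact (hχ N _).1 (htp c hc χ hχM) ⟨x, of_decide_eq_true hΘ, hj⟩)
  have hN := (hrank.mono_height hl').mono (Set.subset_univ _)
  exact hWn (((uDef_rankGE.{u, v, max u v w, ua, max u v w, max u v w} φ k W n
    (γ := PEmpty.{(max u v w) + 1}) (P := fun K _ _ d y => True) (UDef.const True)).map_iff g
      PEmpty.elim).1 hN)

end Simple

/-! ### Countable local character in simple theories -/

section LocalCharacter

variable {L : FirstOrder.Language.{u, v}}

/-- Finitely many generators give countably many combinations, built in stages. This makes the final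
bound independent of the size of `L`. -/
theorem countable_boolGen {α : Type} (Δ : Finset (L.Formula α)) :
    {φ : L.Formula α | BoolGen Δ φ}.Countable := by
  let C : ℕ → Set (L.Formula α) := fun i => Nat.rec ((Δ : Set (L.Formula α)) ∪ {⊥})
    (fun _ S => S ∪ (Formula.not '' S ∪ (Set.image2 (· ⊓ ·) S S ∪ Set.image2 (· ⊔ ·) S S))) i
  have hC : ∀ i, (C i).Countable := by
    intro i
    induction i with
    | zero => exact Δ.countable_toSet.union (Set.countable_singleton _)
    | succ i ih =>
      exact ih.union ((ih.image _).union ((ih.image2 ih _).union (ih.image2 ih _)))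
  have hmono : Monotone C := monotone_nat_of_le_succ fun i => Set.subset_union_left
  refine (Set.countable_iUnion hC).mono fun φ hφ => ?_
  refine Set.mem_iUnion.2 ?_
  induction hφ with
  | of φ h => exact ⟨0, Or.inl h⟩
  | bot => exact ⟨0, Or.inr rfl⟩
  | not φ _ ih =>
    obtain ⟨i, hi⟩ := ih
    exact ⟨i + 1, Or.inr (Or.inl ⟨φ, hi, rfl⟩)⟩
  | inf φ ψ _ _ ih ih' =>
    obtain ⟨i, hi⟩ := ih
    obtain ⟨j, hj⟩ := ih'
    exact ⟨max i j + 1, Or.inr (Or.inr (Or.inl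
      ⟨φ, hmono (le_max_left i j) hi, ψ, hmono (le_max_right i j) hj, rfl⟩))⟩
  | sup φ ψ _ _ ih ih' =>
    obtain ⟨i, hi⟩ := ih
    obtain ⟨j, hj⟩ := ih'
    exact ⟨max i j + 1, Or.inr (Or.inr (Or.inr
      ⟨φ, hmono (le_max_left i j) hi, ψ, hmono (le_max_right i j) hj, rfl⟩))⟩

/-- In a simple theory, if `p` forks over `B`, then some finite conjunction of members of `p`
divides over `B`. -/
theorem IsSimple.exists_kDiv_of_forks {T : L.Theory} (hT : IsSimple.{u, v, max u v w} T)
    {M : Type max u v w} [L.Structure M] [Nonempty M] [M ⊨ T] {n : ℕ}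
    {p : Set (ParamFormula L n M)} {B : Set M} (hp : Forks p B) :
    ∃ F : Finset (ParamFormula L n M), (F : Set (ParamFormula L n M)) ⊆ p ∧
      ∃ K, KDiv K (Subtype.val : B → M) (Formula.iInf fun θ : F => θ.1) id := by
  classical
  obtain ⟨N, _, f, r, m, φ, b, hdiv, himp⟩ := hp
  have : Nonempty N := Nonempty.map f inferInstance
  have : N ⊨ T := (f.theory_model_iff T).1 inferInstance
  choose k hk using fun j => (divides_iff.{u, v, w} _ _ _).1 (hdiv j)
  -- All elements of `N` become parameter variables, so that one tuple, `id`, serves all disjuncts.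
  let Φ : Fin r → L.Formula (Fin n ⊕ N) := fun j => (φ j).relabel (Sum.map id (b j))
  have hΦ : ∀ j, KDiv (k j) (f ∘ (Subtype.val : B → M)) (Φ j) id := fun j =>
    ((kDiv_relabel_iff (f := b j) (b := id)).2 (hk j)).mono (f ∘ (Subtype.val : B → M)) fun i : B =>
      ⟨⟨f i.1, Set.mem_image_of_mem f i.2⟩, rfl⟩
  have hΦr : ∀ j (K : Type max u v w) [L.Structure K] (x : Fin n → K) (g : N → K),
      (Φ j).Realize (Sum.elim x g) ↔ (φ j).Realize (Sum.elim x fun i => g (b j i)) := by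
    intro j K _ x g
    rw [Formula.realize_relabel, Sum.elim_comp_map]
    rfl
  obtain ⟨F, hFp, hF⟩ : ∃ F : Finset (ParamFormula L n M), (F : Set (ParamFormula L n M)) ⊆ p ∧
      ∀ x : Fin n → N, (∀ θ ∈ F, Formula.Realize θ (Sum.elim x f)) →
        ∃ j, (Φ j).Realize (Sum.elim x id) := by
    by_contra! hno
    let P : p ⊕ Fin r → ∀ (K : Type max u v w) [L.Structure K] [Nonempty K],
        (Fin n → K) → (N → K) → Prop := fun q K _ _ x E =>
      match q with
      | Sum.inl θ => Formula.Realize θ.1 (Sum.elim x (E ∘ f))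
      | Sum.inr j => ¬ (Φ j).Realize (Sum.elim x E)
    obtain ⟨N', _, _, g, x, hx⟩ := exists_elementary_of_uDef.{u, v, max u v w, 0, max u v w}
      (L := L) (P := P) (by
        rintro (θ | j)
        · refine UDef.realize θ.1 (fun M d => Sum.elim (d ∘ Sum.inl) ((d ∘ Sum.inr) ∘ f))
            (Sum.map id f) fun M d => ?_
          funext j
          rcases j with j | j <;> rfl
        · refine (UDef.realize (Φ j) (fun M d => Sum.elim (d ∘ Sum.inl) (d ∘ Sum.inr)) id
            fun M d => ?_).not
          funext j
          rcases j with j | j <;> rfl)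
      (M := N) id (by
        intro G
        obtain ⟨x, hx, hxj⟩ := hno (G.toLeft.image Subtype.val) (by
          intro θ hθ
          obtain ⟨θ', -, rfl⟩ := Finset.mem_image.1 (Finset.mem_coe.1 hθ)
          exact θ'.2)
        refine ⟨x, ?_⟩
        rintro (θ | j) hq
        · exact hx _ (Finset.mem_image_of_mem _ (Finset.mem_toLeft.2 hq))
        · exact hxj j)
    obtain ⟨j, hj⟩ := himp N' g x fun θ hθ => hx (Sum.inl ⟨θ, hθ⟩)
    exact hx (Sum.inr j) ((hΦr j N' x g).2 hj)
  refine ⟨F, hFp, ?_⟩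
  let Θ : L.Formula (Fin n ⊕ M) := Formula.iInf fun θ : F => θ.1
  obtain ⟨K, hK⟩ := hT.exists_kDiv_of_cover.{u, v, w} (M := N) hΦ (Θ.relabel (Sum.map id f)) (by
    intro x hx
    refine hF x fun θ hθ => ?_
    rw [Formula.realize_relabel, Sum.elim_comp_map, Formula.realize_iInf] at hx
    exact hx ⟨θ, hθ⟩)
  exact ⟨K, (kDiv_map_iff f).1 hK.of_relabel⟩

/-- `C` collects the parameters occurring in `F`. Allowing any `B ⊇ C` lets one base serve countably
many `F` at once. -/
theorem exists_formula_over {M : Type max u v w} [L.Structure M] {k n : ℕ}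
    {Δ : Finset (L.Formula (Fin k))} {A : Set M} (F : Finset (ParamFormula L n M))
    (hF : (F : Set (ParamFormula L n M)) ⊆ DeltaFormulas Δ n A) :
    ∃ C ⊆ A, C.Countable ∧ ∀ B : Set M, C ⊆ B → ∃ Θ : L.Formula (B ⊕ Fin n), ∀ x : Fin n → M,
      Θ.Realize (Sum.elim Subtype.val x) ↔ ∀ θ ∈ F, Formula.Realize θ (Sum.elim x id) := by
  choose φ σ hφ hσ using fun θ : F => hF θ.2
  let C : Set M := ⋃ θ : F, ⋃ i : Fin k, {c | ∃ a : A, σ θ i = Sum.inr a ∧ c = a}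
  refine ⟨C, ?_, ?_, fun B hB => ?_⟩
  · refine Set.iUnion_subset fun θ => Set.iUnion_subset fun i => ?_
    rintro _ ⟨a, -, rfl⟩
    exact a.2
  · refine Set.countable_iUnion fun θ => Set.countable_iUnion fun i => Set.Subsingleton.countable ?_
    rintro _ ⟨a, ha, rfl⟩ _ ⟨a', ha', rfl⟩
    rw [ha] at ha'
    rw [Sum.inr_injective ha']
  · have hτ : ∀ θ : F, ∃ τ : Fin k → B ⊕ Fin n, ∀ x : Fin n → M,
        Sum.elim Subtype.val x ∘ τ = Sum.elim x id ∘ fun i => Sum.map id Subtype.val (σ θ i) := by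
      intro θ
      have : ∀ i, ∃ t : B ⊕ Fin n, ∀ x : Fin n → M,
          Sum.elim Subtype.val x t = Sum.elim x id (Sum.map id Subtype.val (σ θ i)) := by
        intro i
        rcases h : σ θ i with j | a
        · exact ⟨Sum.inr j, fun x => rfl⟩
        · exact ⟨Sum.inl ⟨a, hB (Set.mem_iUnion.2 ⟨θ, Set.mem_iUnion.2 ⟨i, a, h, rfl⟩⟩)⟩,
            fun x => rfl⟩
      choose τ hτ using this
      exact ⟨τ, fun x => funext fun i => hτ i x⟩
    choose τ hτ using hτ
    refine ⟨Formula.iInf fun θ : F => (φ θ).relabel (τ θ), fun x => ?_⟩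
    rw [Formula.realize_iInf, Subtype.forall]
    refine forall₂_congr fun θ hθ => ?_
    have h := hσ ⟨θ, hθ⟩
    rw [Formula.realize_relabel, hτ, ← Formula.realize_relabel, ← h]

/-- Conjunctions of `Δ`-formulas, with parameters replaced by variables. -/
abbrev DeltaScheme {k : ℕ} (Δ : Finset (L.Formula (Fin k))) (n : ℕ) : Type _ :=
  Σ m : ℕ, Σ r : ℕ, Fin r → {φ : L.Formula (Fin k) // BoolGen Δ φ} × (Fin k → Fin n ⊕ Fin m)

/-- The formula described by a scheme. -/
noncomputable def DeltaScheme.formula {k : ℕ} {Δ : Finset (L.Formula (Fin k))} {n : ℕ}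
    (q : DeltaScheme Δ n) : L.Formula (Fin n ⊕ Fin q.1) :=
  Formula.iInf fun i => (q.2.2 i).1.1.relabel (q.2.2 i).2

/-- Separates the shape of a finite conjunction, one of countably many when `Δ` is fixed, from its
parameters. The arbitrary map `c` keeps the equivalence when the parameters are replaced, as
dividing requires. -/
theorem exists_deltaScheme {M : Type max u v w} [L.Structure M] [Nonempty M] {k n : ℕ}
    {Δ : Finset (L.Formula (Fin k))} {A : Set M} (F : Finset (ParamFormula L n M))
    (hF : (F : Set (ParamFormula L n M)) ⊆ DeltaFormulas Δ n A) :
    ∃ (q : DeltaScheme Δ n) (a : Fin q.1 → M), ∀ (x : Fin n → M) (c : M → M),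
      q.formula.Realize (Sum.elim x (c ∘ a)) ↔ ∀ θ ∈ F, Formula.Realize θ (Sum.elim x c) := by
  choose φ σ hφ hσ using fun θ : F => hF θ.2
  obtain ⟨r, ⟨e⟩⟩ := Finite.exists_equiv_fin F
  obtain ⟨m, ⟨e'⟩⟩ := Finite.exists_equiv_fin (F × Fin k)
  let a : Fin m → M := fun j => Sum.elim (fun _ => Classical.arbitrary M) Subtype.val
    (σ (e'.symm j).1 (e'.symm j).2)
  let τ : F → Fin k → Fin n ⊕ Fin m := fun θ i => Sum.map id (fun _ => e' (θ, i)) (σ θ i)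
  have hτ : ∀ (x : Fin n → M) (c : M → M) (θ : F),
      Sum.elim x (c ∘ a) ∘ τ θ = Sum.elim x c ∘ fun i => Sum.map id Subtype.val (σ θ i) := by
    intro x c θ
    funext i
    rcases h : σ θ i with j | d <;> simp [τ, a, h]
  refine ⟨⟨m, r, fun i => (⟨φ (e.symm i), hφ _⟩, τ (e.symm i))⟩, a, fun x c => ?_⟩
  rw [DeltaScheme.formula, Formula.realize_iInf, e.symm.forall_congr_left, Subtype.forall]
  refine forall₂_congr fun θ hθ => ?_
  simp only [Equiv.symm_symm, Equiv.symm_apply_apply]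
  have h := hσ ⟨θ, hθ⟩
  rw [Formula.realize_relabel, hτ, ← Formula.realize_relabel, ← h]

/-- In a simple theory, every local type does not fork over some countable set. -/
theorem IsSimple.localCharacter_aleph_one {T : L.Theory} (hT : IsSimple.{u, v, max u v w} T) :
    LocalCharacter.{u, v, max u v w} T (Cardinal.aleph 1) := by
  classical
  intro M A k n Δ p hp
  have hpΔ : p ⊆ DeltaFormulas Δ n A := hp.1.1
  have hcons : Consistent p := hp.1.2
  let X : Finset (ParamFormula L n M) → Set (Fin n → M) := fun F =>
    {x | ∀ θ ∈ F, Formula.Realize θ (Sum.elim x id)}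
  have : Countable {φ : L.Formula (Fin k) // BoolGen Δ φ} := (countable_boolGen Δ).to_subtype
  -- For each shape and each `k`, `N` is the greatest height for which every finite part of `p` has
  -- trees of all widths; the part `F` and the width `W` witness failure at `N + 1`.
  have hrank : ∀ q : DeltaScheme Δ n × ℕ, ∃ (F : Finset (ParamFormula L n M)) (N W : ℕ),
      (F : Set (ParamFormula L n M)) ⊆ p ∧
      ¬ RankGE (fun _ : Unit => q.1.formula) (fun _ => q.2) W (N + 1) (X F) ∧
      ∀ F' : Finset (ParamFormula L n M), (F' : Set (ParamFormula L n M)) ⊆ p → ∀ W',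
        RankGE (fun _ : Unit => q.1.formula) (fun _ => q.2) W' N (X F') := by
    intro q
    have hex : ∃ N, ∃ (F : Finset (ParamFormula L n M)) (W : ℕ),
        (F : Set (ParamFormula L n M)) ⊆ p ∧
        ¬ RankGE (fun _ : Unit => q.1.formula) (fun _ => q.2) W N (X F) := by
      obtain ⟨W, N, h⟩ := hT.exists_not_rankGE.{u, v, w} (M := M)
        (fun _ : Unit => q.1.formula) (fun _ => q.2)
      exact ⟨N, ∅, W, by simp, fun h' => h (h'.mono (Set.subset_univ _))⟩
    obtain ⟨F, W, hF, hFW⟩ := Nat.find_spec hex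
    have hpos : Nat.find hex ≠ 0 := by
      intro h0
      rw [h0] at hFW
      obtain ⟨x, hx⟩ := hcons F hF
      exact hFW ⟨x, fun θ hθ => hx θ hθ⟩
    obtain ⟨N, hN⟩ := Nat.exists_eq_succ_of_ne_zero hpos
    refine ⟨F, N, W, hF, by rwa [hN] at hFW, fun F' hF' W' => ?_⟩
    by_contra hcon
    exact Nat.find_min hex (m := N) (by omega) ⟨F', W', hF', hcon⟩
  choose F N W hFp hF hN using hrank
  choose C hCA hC hCB using fun q => exists_formula_over.{u, v, w} (F q) ((hFp q).trans hpΔ)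
  let B : Set M := ⋃ q, C q
  have hBc : B.Countable := Set.countable_iUnion hC
  refine ⟨B, Set.iUnion_subset hCA, ?_, fun hfork => ?_⟩
  · refine lt_of_le_of_lt (Cardinal.le_aleph0_iff_set_countable.2 hBc) ?_
    rw [← Cardinal.aleph_zero]
    exact Cardinal.aleph_lt_aleph.2 zero_lt_one
  obtain ⟨F₁, hF₁p, K, hK⟩ := hT.exists_kDiv_of_forks.{u, v, w} hfork
  obtain ⟨s, a, hs⟩ := exists_deltaScheme.{u, v, w} F₁ (hF₁p.trans hpΔ)
  let q : DeltaScheme Δ n × ℕ := (s, K)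
  have hKs : KDiv K (Subtype.val : B → M) s.formula a := by
    have : KDiv K (Subtype.val : B → M) (s.formula.relabel (Sum.map id a)) id := by
      refine hK.congr_formula fun x c hx => ?_
      rw [Formula.realize_relabel, Sum.elim_comp_map] at hx
      rw [Formula.realize_iInf, Subtype.forall]
      exact (hs x c).1 hx
    exact this.of_relabel
  obtain ⟨Θ, hΘ⟩ := hCB q B (Set.subset_iUnion C q)
  obtain ⟨χ, hχ⟩ := uDef_rankGE.{u, v, max u v w, 0, 0, max u v w}
    (fun _ : Unit => s.formula) (fun _ => K) (W q) (N q) (γ := B ⊕ Fin s.1)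
    (P := fun K _ _ d x => Θ.Realize (Sum.elim (d ∘ Sum.inl) x) ∧
      s.formula.Realize (Sum.elim x (d ∘ Sum.inr))) (by
    refine UDef.and ?_ ?_
    · refine UDef.realize _ (fun M d => Sum.elim (d ∘ Sum.inl ∘ Sum.inl) (d ∘ Sum.inr))
        (Sum.map Sum.inl id) fun M d => ?_
      funext j
      rcases j with j | j <;> rfl
    · refine UDef.realize _ (fun M d => Sum.elim (d ∘ Sum.inr) (d ∘ Sum.inl ∘ Sum.inr))
        (Sum.elim Sum.inr (Sum.inl ∘ Sum.inr)) fun M d => ?_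
      funext j
      rcases j with j | j <;> rfl)
  -- As `F q ∪ F₁` is a finite part of `p`, it has rank at least `N q`. This is a condition on `a`
  -- over `B`, so dividing over `B` yields `W q + 1` conjugates and a tree of the excluded height `N
  -- q + 1` for `F q`.
  have hχa : χ.Realize (Sum.elim (Subtype.val : B → M) a) := by
    refine (hχ M _).2 ((hN q (F q ∪ F₁) (by
      rw [Finset.coe_union]
      exact Set.union_subset (hFp q) hF₁p) (W q)).mono fun x hx => ⟨?_, ?_⟩)
    · exact (hΘ x).2 fun θ hθ => hx θ (Finset.mem_union_left _ hθ)
    · exact (hs x id).2 fun θ hθ => hx θ (Finset.mem_union_right _ hθ)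
  obtain ⟨c, hc, hk⟩ := hKs χ hχa (W q + 1)
  refine hF q ⟨(), c, hk, fun l => ((hχ M _).1 (hc l)).mono fun x hx => ⟨?_, hx.2⟩⟩
  exact (hΘ x).1 hx.1

end LocalCharacter

/-! ### Failure of local character without simplicity -/

section NotSimple

variable {L : FirstOrder.Language.{u, v}}

/-- The `Δ`-type of a tuple of the model. -/
theorem isDeltaType_setOf_realize {M : Type w} [L.Structure M] {k n : ℕ}
    (Δ : Finset (L.Formula (Fin k))) (A : Set M) (x : Fin n → M) :
    IsDeltaType Δ A {θ | θ ∈ DeltaFormulas Δ n A ∧ Formula.Realize θ (Sum.elim x id)} := by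
  classical
  refine ⟨⟨fun θ hθ => hθ.1, fun F hF => ⟨x, fun θ hθ => (hF hθ).2⟩⟩, ?_⟩
  rintro q ⟨hqΔ, hq⟩ hpq θ hθ
  refine ⟨hqΔ hθ, ?_⟩
  by_contra hx
  obtain ⟨φ, σ, hφ, rfl⟩ := hqΔ hθ
  have hn : φ.not.relabel (fun i => Sum.map id Subtype.val (σ i)) ∈ q := by
    refine hpq ⟨⟨φ.not, σ, hφ.not, rfl⟩, ?_⟩
    rw [Formula.realize_relabel] at hx ⊢
    rwa [Formula.realize_not]
  obtain ⟨y, hy⟩ := hq {_, _} (by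
    rw [Finset.coe_pair]
    exact Set.insert_subset hθ (Set.singleton_subset_iff.2 hn))
  have h1 := hy _ (Finset.mem_coe.2 (Finset.mem_insert_self _ _))
  have h2 := hy _ (Finset.mem_coe.2 (Finset.mem_insert_of_mem (Finset.mem_singleton_self _)))
  rw [Formula.realize_relabel] at h1 h2
  rw [Formula.realize_not] at h2
  exact h2 h1

/-- Regularity of a successor cardinal: at most `κ` initial segments, each of size at most `κ`,
cannot cover it. -/
theorem exists_forall_lt_of_mk_le {κ : Cardinal.{w}} (hκ : ℵ₀ ≤ κ) {B : Type w} (hB : #B ≤ κ)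
    (f : B → (Order.succ κ).ord.ToType) : ∃ i, ∀ b, f b < i := by
  by_contra! h
  have hle : #(Order.succ κ).ord.ToType ≤ κ := by
    have hcov : (Set.univ : Set (Order.succ κ).ord.ToType) ⊆ ⋃ b, Set.Iic (f b) := by
      intro i _
      obtain ⟨b, hb⟩ := h i
      exact Set.mem_iUnion.2 ⟨b, hb⟩
    have hIic : ∀ b, #(Set.Iic (f b)) ≤ κ := by
      intro b
      rw [← Set.Iio_insert]
      refine Cardinal.mk_insert_le.trans ?_
      have hlt := Cardinal.mk_Iio_lt (f b) (by simp)
      rw [Cardinal.mk_ord_toType] at hlt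
      exact Cardinal.add_le_of_le hκ (Order.lt_succ_iff.1 hlt)
        (Cardinal.one_lt_aleph0.le.trans hκ)
    rw [← Cardinal.mk_univ]
    calc #(Set.univ : Set (Order.succ κ).ord.ToType) ≤ #(⋃ b, Set.Iic (f b)) :=
          Cardinal.mk_le_mk_of_subset hcov
      _ ≤ Cardinal.sum fun b => #(Set.Iic (f b)) := Cardinal.mk_iUnion_le_sum_mk
      _ ≤ Cardinal.sum fun _ : B => κ := Cardinal.sum_le_sum _ _ hIic
      _ = #B * κ := Cardinal.sum_const' _ _
      _ ≤ κ := Cardinal.mul_le_of_le hκ hB le_rfl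
  rw [Cardinal.mk_ord_toType] at hle
  exact (Order.lt_succ κ).not_ge hle

/-- From the tree property one obtains long sequences of instances, each of which divides over
the preceding parameters. Only finitely many conditions are considered at a time. -/
theorem HasTreeProperty.exists_finite_chain {M : Type w} [L.Structure M] {n m k : ℕ}
    {φ : L.Formula (Fin n ⊕ Fin m)} (h : HasTreeProperty M k φ) {I : Type w} [LinearOrder I]
    (I₀ : Finset I) (G : Finset (Σ i : I, L.Formula ((Set.Iio i × Fin m) ⊕ Fin m))) :
    ∃ (a : I → Fin m → M) (x : Fin n → M),
      (∀ i ∈ I₀, φ.Realize (Sum.elim x (a i))) ∧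
      ∀ q ∈ G, q.1 ∈ I₀ → q.2.Realize (Sum.elim (fun z => a z.1 z.2) (a q.1)) → ∀ W,
        ∃ c : Fin W → Fin m → M,
          (∀ l, q.2.Realize (Sum.elim (fun z => a z.1 z.2) (c l))) ∧ KIncons k φ c := by
  classical
  obtain ⟨T, hT, hbr⟩ := h
  obtain ⟨a, s, ha, hG⟩ : ∃ (a : I → Fin m → M) (s : List ℕ),
      (∀ i ∈ I₀, ∃ t, t <+: s ∧ a i = T t) ∧
      ∀ q ∈ G, q.1 ∈ I₀ → q.2.Realize (Sum.elim (fun z => a z.1 z.2) (a q.1)) → ∀ W,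
        ∃ c : Fin W → Fin m → M,
          (∀ l, q.2.Realize (Sum.elim (fun z => a z.1 z.2) (c l))) ∧ KIncons k φ c := by
    induction I₀ using Finset.induction_on_max with
    | empty => exact ⟨fun _ => T [], [], by simp, by simp⟩
    | insert i I₀ hi ih =>
      obtain ⟨a, s, ha, hG⟩ := ih
      -- Colour the children of the current node by the truth values of the formulas in `G`.
      -- Infinitely many share a colour; one of them becomes `a i`, and the whole class supplies the
      -- `k`-inconsistent sequences.
      let f : ℕ → G → Prop := fun j q =>
        q.1.2.Realize (Sum.elim (fun z => a z.1 z.2) (T (s ++ [j])))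
      obtain ⟨y, hy⟩ := Finite.exists_infinite_fiber f
      obtain ⟨⟨j₀, hj₀⟩⟩ := hy.nonempty
      let a' : I → Fin m → M := Function.update a i (T (s ++ [j₀]))
      have ha'i : a' i = T (s ++ [j₀]) := Function.update_self ..
      have ha'lt : ∀ j, j < i → a' j = a j := fun j hj => Function.update_of_ne hj.ne _ _
      have hIio : ∀ j, j ≤ i → (fun z : Set.Iio j × Fin m => a' z.1 z.2) =
          fun z => a z.1 z.2 := by
        intro j hj
        funext z
        rw [ha'lt _ (lt_of_lt_of_le z.1.2 hj)]
      refine ⟨a', s ++ [j₀], fun j hj => ?_, ?_⟩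
      · rcases Finset.mem_insert.1 hj with rfl | hj
        · exact ⟨s ++ [j₀], List.prefix_rfl, ha'i⟩
        · obtain ⟨t, ht, hat⟩ := ha j hj
          exact ⟨t, ht.trans (List.prefix_append _ _), (ha'lt j (hi j hj)).trans hat⟩
      · rintro ⟨j, ψ⟩ hq hj
        rcases Finset.mem_insert.1 hj with hji | hj
        · change j = i at hji
          subst hji
          simp only [hIio j le_rfl, ha'i]
          intro hψ W
          let em := (Function.Embedding.trans Fin.valEmbedding
            (Infinite.natEmbedding (f ⁻¹' {y}))).trans (Function.Embedding.subtype _) (α := Fin W)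
          refine ⟨fun l => T (s ++ [em l]), fun l => ?_, KIncons.comp (hT s) em⟩
          have hl : f (em l) = y := (Infinite.natEmbedding (f ⁻¹' {y}) l).2
          have hj : f j₀ = y := hj₀
          have := congrFun (hl.trans hj.symm) ⟨⟨j, ψ⟩, hq⟩
          exact this.mpr hψ
        · have hlt : j < i := hi j hj
          simp only [hIio j hlt.le, ha'lt j hlt]
          exact hG ⟨j, ψ⟩ hq hj
  obtain ⟨x, hx⟩ := hbr (fun i => s.getD i 0) (Finset.range (s.length + 1))
  refine ⟨a, x, fun i hi => ?_, hG⟩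
  obtain ⟨t, ht, hat⟩ := ha i hi
  have hts : (List.range t.length).map (fun i => s.getD i 0) = t := by
    refine List.ext_getElem (by simp) fun j h1 h2 => ?_
    have hjs : j < s.length := h2.trans_le ht.length_le
    rw [List.getElem_map, List.getElem_range, List.getD_eq_getElem _ _ hjs, ht.getElem]
  have := hx t.length (Finset.mem_range.2 (Nat.lt_succ_of_le ht.length_le))
  rwa [hts, ← hat] at this

/-- Compactness from `HasTreeProperty.exists_finite_chain`. The order `I` is arbitrary, so the chain
can outgrow any cardinal. -/
theorem HasTreeProperty.exists_chain {M : Type max u v w} [L.Structure M] [Nonempty M]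
    {n m k : ℕ} {φ : L.Formula (Fin n ⊕ Fin m)} (h : HasTreeProperty M k φ)
    (I : Type max u v w) [LinearOrder I] :
    ∃ (N : Type max u v w) (_ : L.Structure N) (_ : Nonempty N) (_ : M ↪ₑ[L] N)
      (a : I → Fin m → N) (x : Fin n → N), (∀ i, φ.Realize (Sum.elim x (a i))) ∧
      ∀ i, KDiv k (fun z : Set.Iio i × Fin m => a z.1 z.2) φ (a i) := by
  classical
  let P : (I ⊕ ((Σ i : I, L.Formula ((Set.Iio i × Fin m) ⊕ Fin m)) × ℕ)) →
      ∀ (K : Type max u v w) [L.Structure K] [Nonempty K],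
        (Fin n ⊕ (I × Fin m) → K) → (PEmpty.{1} → K) → Prop := fun q K _ _ d _ =>
    match q with
    | Sum.inl i => φ.Realize (Sum.elim (d ∘ Sum.inl) fun y => d (Sum.inr (i, y)))
    | Sum.inr (⟨i, ψ⟩, W) =>
      ψ.Realize (Sum.elim (fun z => d (Sum.inr (z.1.1, z.2))) fun y => d (Sum.inr (i, y))) →
        ∃ c : Fin W → Fin m → K,
          (∀ l, ψ.Realize (Sum.elim (fun z => d (Sum.inr (z.1.1, z.2))) (c l))) ∧ KIncons k φ c
  obtain ⟨N, _, _, g, d, hd⟩ := exists_elementary_of_uDef.{u, v, w, max u v w, 0} (L := L)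
    (P := P) (by
      rintro (i | ⟨⟨i, ψ⟩, W⟩)
      · refine UDef.realize φ
          (fun K d => Sum.elim (d ∘ Sum.inl ∘ Sum.inl) fun y => d (Sum.inl (Sum.inr (i, y))))
          (Sum.elim (Sum.inl ∘ Sum.inl) fun y => Sum.inl (Sum.inr (i, y))) fun K d => ?_
        funext j
        rcases j with j | j <;> rfl
      · refine UDef.imp ?_ ((uDef_exists_kIncons k W φ ψ).comp
          fun z => Sum.inl (Sum.inr (z.1.1, z.2)))
        refine UDef.realize ψ
          (fun K d => Sum.elim (fun z => d (Sum.inl (Sum.inr (z.1.1, z.2))))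
            fun y => d (Sum.inl (Sum.inr (i, y))))
          (Sum.elim (fun z => Sum.inl (Sum.inr (z.1.1, z.2)))
            fun y => Sum.inl (Sum.inr (i, y))) fun K d => ?_
        funext j
        rcases j with j | j <;> rfl)
    (M := M) PEmpty.elim (by
      intro F
      let G := F.toRight.image Prod.fst
      obtain ⟨a, x, hx, hG⟩ := h.exists_finite_chain (F.toLeft ∪ G.image Sigma.fst) G
      refine ⟨Sum.elim x fun z => a z.1 z.2, ?_⟩
      rintro (i | ⟨⟨i, ψ⟩, W⟩) hq
      · exact hx i (Finset.mem_union_left _ (Finset.mem_toLeft.2 hq))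
      · have hiG : (⟨i, ψ⟩ : Σ i : I, L.Formula ((Set.Iio i × Fin m) ⊕ Fin m)) ∈ G :=
          Finset.mem_image.2 ⟨_, Finset.mem_toRight.2 hq, rfl⟩
        exact fun hψ => hG ⟨i, ψ⟩ hiG
          (Finset.mem_union_right _ (Finset.mem_image_of_mem _ hiG)) hψ W)
  refine ⟨N, inferInstance, inferInstance, g, fun i y => d (Sum.inr (i, y)), d ∘ Sum.inl,
    fun i => hd (Sum.inl i), fun i ψ hψ W => hd (Sum.inr (⟨i, ψ⟩, W)) hψ⟩

/-- If a theory is not simple, no cardinal bounds the size of the sets needed in local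
character. -/
theorem not_localCharacter_of_not_isSimple {T : L.Theory}
    (hT : ¬ IsSimple.{u, v, max u v w} T) (κ : Cardinal.{max u v w}) :
    ¬ LocalCharacter.{u, v, max u v w} T κ := by
  classical
  intro hκ
  simp only [IsSimple, not_forall, not_not] at hT
  obtain ⟨M, n, m, k, φ, hφ⟩ := hT
  let κ' := max κ ℵ₀
  obtain ⟨N, _, _, g, a, x, hx, hdiv⟩ :=
    HasTreeProperty.exists_chain.{u, v, w} hφ (Order.succ κ').ord.ToType
  have : N ⊨ T := (g.theory_model_iff T).1 inferInstance
  let A : Set N := {c | ∃ i y, c = a i y}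
  let Δ : Finset (L.Formula (Fin (n + m))) := {φ.relabel finSumFinEquiv}
  let p : Set (ParamFormula L n N) :=
    {θ | θ ∈ DeltaFormulas Δ n A ∧ Formula.Realize θ (Sum.elim x id)}
  obtain ⟨B, hBA, hB, hfork⟩ := hκ (Theory.ModelType.of T N) A (n + m) n Δ p
    (isDeltaType_setOf_realize Δ A x)
  choose i y hiy using fun b : B => hBA b.2
  -- Every element of `B` is a coordinate of some `a i`, and `j` lies above all the indices chosen.
  -- So `φ(x, a j)`, which belongs to `p`, divides over `B`.
  obtain ⟨j, hj⟩ := exists_forall_lt_of_mk_le (le_max_right κ ℵ₀)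
    (hB.le.trans (le_max_left κ ℵ₀)) i
  refine hfork ⟨N, inferInstance, ElementaryEmbedding.refl L N, 1, fun _ => m, fun _ => φ,
    fun _ => a j, fun _ => ?_, fun N' _ g' x' hx' => ⟨0, ?_⟩⟩
  · refine (divides_iff.{u, v, w} _ _ _).2 ⟨k, (hdiv j).mono _ ?_⟩
    rintro ⟨_, b, hb, rfl⟩
    exact ⟨(⟨i ⟨b, hb⟩, hj ⟨b, hb⟩⟩, y ⟨b, hb⟩), hiy ⟨b, hb⟩⟩
  · let σ : Fin (n + m) → Fin n ⊕ A := fun t =>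
      Sum.map id (fun y => (⟨a j y, j, y, rfl⟩ : A)) (finSumFinEquiv.symm t)
    have hreal : ∀ {K : Type max u v w} [L.Structure K] (z : Fin n → K) (f : N → K),
        ((φ.relabel finSumFinEquiv).relabel fun t => Sum.map id Subtype.val (σ t)).Realize
          (Sum.elim z f) ↔ φ.Realize (Sum.elim z fun y => f (a j y)) := by
      intro K _ z f
      rw [Formula.realize_relabel, Formula.realize_relabel]
      have : (Sum.elim z f ∘ fun t => Sum.map id Subtype.val (σ t)) ∘ finSumFinEquiv =
          Sum.elim z fun y => f (a j y) := by
        funext t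
        simp only [Function.comp_apply, σ, Equiv.symm_apply_apply]
        rcases t with t | t <;> rfl
      rw [this]
    exact (hreal x' fun e => g' e).1 (hx' _
      ⟨⟨_, σ, BoolGen.of _ (Finset.mem_singleton_self _), rfl⟩, (hreal x id).2 (hx j)⟩)

end NotSimple

/-! ### Algebraic independence and the lower bound -/

section Algebraic

variable {L : FirstOrder.Language.{u, v}} {M : Type max u v w} [L.Structure M]

/-- The algebraic closure of a set of parameters. -/
def acl (L : FirstOrder.Language.{u, v}) {M : Type max u v w} [L.Structure M] (S : Set M) :
    Set M :=
  {y | ∃ ψ : L.Formula (S ⊕ Fin 1), ψ.Realize (Sum.elim Subtype.val fun _ => y) ∧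
    {z | ψ.Realize (Sum.elim Subtype.val fun _ => z)}.Finite}

theorem acl_mono {S S' : Set M} (h : S ⊆ S') : acl.{u, v, w} L S ⊆ acl.{u, v, w} L S' := by
  rintro y ⟨ψ, hψ, hfin⟩
  have key : ∀ z : M, (ψ.relabel (Sum.map (Set.inclusion h) id)).Realize
      (Sum.elim (Subtype.val : S' → M) fun _ => z) ↔
      ψ.Realize (Sum.elim Subtype.val fun _ => z) := by
    intro z
    rw [Formula.realize_relabel, Sum.elim_comp_map]
    rfl
  refine ⟨_, (key y).2 hψ, ?_⟩
  simp only [key]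
  exact hfin

theorem subset_acl (S : Set M) : S ⊆ acl.{u, v, w} L S := by
  intro y hy
  let ψ : L.Formula (S ⊕ Fin 1) := (Term.var (Sum.inl ⟨y, hy⟩)).equal (Term.var (Sum.inr 0))
  have key : ∀ z : M, ψ.Realize (Sum.elim Subtype.val fun _ => z) ↔ y = z := by
    intro z
    simp [ψ]
  refine ⟨ψ, (key y).2 rfl, ?_⟩
  simp only [key]
  exact (Set.finite_singleton y).subset fun z hz => hz.symm

/-- Each formula over `S` contributes only finitely many algebraic elements, so counting formulas
suffices. -/
theorem mk_acl_le (S : Set M) :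
    #(acl.{u, v, w} L S) ≤ max (max ℵ₀ (Cardinal.lift.{max u v w} L.card)) #S := by
  let κ : Cardinal.{max u v w} := max (max ℵ₀ (Cardinal.lift.{max u v w} L.card)) #S
  have hκ : ℵ₀ ≤ κ := (le_max_left _ _).trans (le_max_left _ _)
  have hform : #(L.Formula (S ⊕ Fin 1)) ≤ κ := by
    have h1 : #(L.Formula (S ⊕ Fin 1)) ≤ #(Σ n, L.BoundedFormula (S ⊕ Fin 1) n) :=
      Cardinal.mk_le_of_injective (f := fun φ => ⟨0, φ⟩) fun φ ψ h => by simpa using h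
    refine h1.trans (BoundedFormula.card_le.trans ?_)
    refine max_le hκ (Cardinal.add_le_of_le hκ ?_ ?_)
    · rw [Cardinal.mk_sum, Cardinal.lift_add, Cardinal.lift_lift, Cardinal.lift_id', Cardinal.mk_fin,
        Cardinal.lift_natCast, Cardinal.lift_natCast]
      exact Cardinal.add_le_of_le hκ (le_max_right _ _) (Cardinal.natCast_lt_aleph0.le.trans hκ)
    · exact (le_max_right _ _).trans (le_max_left _ _)
  have hsub : acl.{u, v, w} L S ⊆ ⋃ ψ : L.Formula (S ⊕ Fin 1),
      {y | ψ.Realize (Sum.elim Subtype.val fun _ => y) ∧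
        {z | ψ.Realize (Sum.elim Subtype.val fun _ => z)}.Finite} := fun y ⟨ψ, hψ⟩ =>
    Set.mem_iUnion.2 ⟨ψ, hψ⟩
  have hfin : ∀ ψ : L.Formula (S ⊕ Fin 1),
      #{y : M | ψ.Realize (Sum.elim Subtype.val fun _ => y) ∧
        {z | ψ.Realize (Sum.elim Subtype.val fun _ => z)}.Finite} ≤ ℵ₀ := by
    intro ψ
    rw [Cardinal.le_aleph0_iff_set_countable]
    by_cases h : {z : M | ψ.Realize (Sum.elim Subtype.val fun _ => z)}.Finite
    · exact h.countable.mono fun y hy => hy.1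
    · simp [h]
  calc #(acl.{u, v, w} L S) ≤ _ := Cardinal.mk_le_mk_of_subset hsub
    _ ≤ _ := Cardinal.mk_iUnion_le_sum_mk
    _ ≤ Cardinal.sum fun _ : L.Formula (S ⊕ Fin 1) => ℵ₀ := Cardinal.sum_le_sum _ _ hfin
    _ = #(L.Formula (S ⊕ Fin 1)) * ℵ₀ := Cardinal.sum_const' _ _
    _ ≤ κ := Cardinal.mul_le_of_le hκ hform hκ

/-- Large sets contain finite algebraically independent tuples. -/
theorem exists_independent (n : ℕ) (X C : Set M)
    (hC : #C ≤ max ℵ₀ (Cardinal.lift.{max u v w} L.card))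
    (hX : Order.succ^[n] (max ℵ₀ (Cardinal.lift.{max u v w} L.card)) ≤ #X) :
    ∃ a : Fin n → M, (∀ i, a i ∈ X) ∧ ∀ i, a i ∉ acl.{u, v, w} L (C ∪ a '' {j | j ≠ i}) := by
  induction n generalizing X C with
  | zero => exact ⟨Fin.elim0, fun i => i.elim0, fun i => i.elim0⟩
  | succ n ih =>
    let μ : Cardinal.{max u v w} := max ℵ₀ (Cardinal.lift.{max u v w} L.card)
    have hμ : ℵ₀ ≤ μ := le_max_left _ _
    have hle : μ ≤ Order.succ^[n] μ := by
      exact Function.id_le_iterate_of_id_le (fun x => Order.le_succ x) n μ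
    rw [Function.iterate_succ_apply'] at hX
    -- Choose `y` outside the closure of `C ∪ X₀`, then the other elements inside `X₀`, independent
    -- over `C ∪ {y}`. Both directions of independence hold without the exchange property; each
    -- element costs one successor cardinal.
    obtain ⟨X₀, hX₀X, hX₀⟩ := Cardinal.le_mk_iff_exists_subset.1 ((Order.le_succ _).trans hX)
    have hcard : #(acl.{u, v, w} L (C ∪ X₀)) < #X := by
      refine lt_of_le_of_lt ((mk_acl_le.{u, v, w} (C ∪ X₀)).trans ?_) (Order.succ_le_iff.1 hX)
      refine max_le hle ((Cardinal.mk_union_le _ _).trans ?_)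
      exact Cardinal.add_le_of_le (hμ.trans hle) (hC.trans hle) hX₀.le
    obtain ⟨y, hyX, hy⟩ := Cardinal.sdiff_nonempty_of_mk_lt_mk hcard
    obtain ⟨a, haX, ha⟩ := ih X₀ (C ∪ {y})
      ((Cardinal.mk_union_le _ _).trans (Cardinal.add_le_of_le hμ hC (by
        rw [Cardinal.mk_singleton]
        exact Cardinal.one_lt_aleph0.le.trans hμ))) hX₀.ge
    refine ⟨Fin.cons y a, Fin.cases hyX fun i => hX₀X (haX i), Fin.cases ?_ fun i => ?_⟩
    · refine fun h => hy (acl_mono (Set.union_subset_union_right _ ?_) h)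
      rintro _ ⟨j, hj, rfl⟩
      obtain ⟨j, rfl⟩ := Fin.exists_succ_eq.2 hj
      exact haX j
    · refine fun h => ha i (acl_mono ?_ h)
      rintro z (hz | ⟨j, hj, rfl⟩)
      · exact Or.inl (Or.inl hz)
      · induction j using Fin.cases with
        | zero => exact Or.inl (Or.inr rfl)
        | succ j => exact Or.inr ⟨j, fun h => hj (h ▸ rfl), rfl⟩

/-- Local character needs infinite sets. -/
theorem aleph0_le_of_localCharacter {T : L.Theory}
    (hinf : ∃ M : Theory.ModelType.{u, v, max u v w} T, Infinite M) {κ : Cardinal.{max u v w}}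
    (hκ : LocalCharacter.{u, v, max u v w} T κ) : ℵ₀ ≤ κ := by
  classical
  by_contra! hlt
  obtain ⟨n, rfl⟩ := Cardinal.lt_aleph0.1 hlt
  obtain ⟨M₀, hM₀⟩ := hinf
  obtain ⟨M, hM⟩ := Theory.exists_large_model_of_infinite_model.{u, v, max u v w, max u v w} T
    (Order.succ^[n] (max ℵ₀ (Cardinal.lift.{max u v w} L.card) : Cardinal.{max u v w})) M₀
  rw [Cardinal.lift_id, ← Cardinal.mk_univ] at hM
  obtain ⟨a, -, ha⟩ := exists_independent.{u, v, w} (L := L) n (Set.univ : Set M) ∅ (by simp) hM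
  have hinj : Function.Injective a := by
    intro i j hij
    by_contra hne
    exact ha i (subset_acl _ (Or.inr ⟨j, fun h => hne h.symm, hij.symm⟩))
  let eqn : L.Formula (Fin 2) := (Term.var 0).equal (Term.var 1)
  let p : Set (ParamFormula L n M) :=
    {θ | θ ∈ DeltaFormulas {eqn} n (Set.range a) ∧ Formula.Realize θ (Sum.elim a id)}
  obtain ⟨B, hBA, hB, hfork⟩ := hκ M (Set.range a) 2 n {eqn} p
    (isDeltaType_setOf_realize {eqn} (Set.range a) a)
  obtain ⟨i, hi⟩ : ∃ i, a i ∉ B := by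
    by_contra! hall
    refine hB.not_ge ?_
    have : #(Set.range a) = n := by
      have h := Cardinal.mk_range_eq_of_injective hinj
      rwa [Cardinal.lift_uzero, Cardinal.mk_fin, Cardinal.lift_natCast] at h
    rw [← this]
    exact Cardinal.mk_le_mk_of_subset (Set.range_subset_iff.2 hall)
  have hBi : B ⊆ ∅ ∪ a '' {j | j ≠ i} := by
    intro b hb
    obtain ⟨j, rfl⟩ := hBA hb
    exact Or.inr ⟨j, fun h => hi (h ▸ hb), rfl⟩
  have hai : a i ∉ acl.{u, v, w} L B := fun h => ha i (acl_mono hBi h)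
  let φ : L.Formula (Fin n ⊕ Fin 1) := (Term.var (Sum.inl i)).equal (Term.var (Sum.inr 0))
  have hφ : ∀ {K : Type max u v w} [L.Structure K] (x : Fin n → K) (y : Fin 1 → K),
      φ.Realize (Sum.elim x y) ↔ x i = y 0 := by
    intro K _ x y
    simp [φ]
  refine hfork ⟨M, inferInstance, ElementaryEmbedding.refl L M, 1, fun _ => 1, fun _ => φ,
    fun _ _ => a i, fun _ => ?_, fun N' _ g x hx => ⟨0, (hφ _ _).2 ?_⟩⟩
  -- As `a i` is not algebraic over `B`, each formula in its type over `B` has infinitely many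
  -- solutions, and `xᵢ = c`, `xᵢ = c'` contradict each other for distinct `c`, `c'`.
  · refine (divides_iff.{u, v, w} _ _ _).2 ⟨2, KDiv.mono (e := (Subtype.val : B → M)) ?_ _ ?_⟩
    · intro ψ hψ W
      have hinf : {z : M | ψ.Realize (Sum.elim Subtype.val fun _ => z)}.Infinite :=
        fun hfin => hai ⟨ψ, hψ, hfin⟩
      let em := hinf.natEmbedding
      refine ⟨fun l _ => em l, fun l => (em l).2, ?_⟩
      rintro s hs ⟨x, hx⟩
      obtain ⟨l, l', hne, rfl⟩ := Finset.card_eq_two.1 hs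
      have h1 := (hφ _ _).1 (hx l (by simp))
      have h2 := (hφ _ _).1 (hx l' (by simp))
      exact hne (Fin.ext (em.injective (Subtype.ext (h1.symm.trans h2))))
    · rintro ⟨_, b, hb, rfl⟩
      exact ⟨⟨b, hb⟩, rfl⟩
  · let σ : Fin 2 → Fin n ⊕ Set.range a := ![Sum.inl i, Sum.inr ⟨a i, i, rfl⟩]
    have hreal : ∀ {K : Type max u v w} [L.Structure K] (z : Fin n → K) (f : M → K),
        (eqn.relabel fun t => Sum.map id Subtype.val (σ t)).Realize (Sum.elim z f) ↔
          z i = f (a i) := by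
      intro K _ z f
      rw [Formula.realize_relabel]
      simp [eqn, σ]
    exact (hreal x fun e => g e).1 (hx _
      ⟨⟨_, σ, BoolGen.of _ (Finset.mem_singleton_self _), rfl⟩, (hreal a id).2 rfl⟩)

end Algebraic

/-! ### The values of `kappaLoc` -/

section KappaLoc

variable {L : FirstOrder.Language.{u, v}} {T : L.Theory}

theorem kappaLoc_of_isSimple (hinf : ∃ M : Theory.ModelType.{u, v, max u v w} T, Infinite M)
    (hT : IsSimple.{u, v, max u v w} T) :
    kappaLoc.{u, v, max u v w} T = ((ℵ₀ : Cardinal.{max u v w}) : WithTop Cardinal) ∨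
      kappaLoc.{u, v, max u v w} T =
        ((Cardinal.aleph 1 : Cardinal.{max u v w}) : WithTop Cardinal) := by
  have h1 := hT.localCharacter_aleph_one.{u, v, w}
  rw [kappaLoc, if_pos ⟨_, h1⟩]
  have hle : sInf {κ | LocalCharacter.{u, v, max u v w} T κ} ≤ Cardinal.aleph 1 := csInf_le' h1
  have hge : ℵ₀ ≤ sInf {κ | LocalCharacter.{u, v, max u v w} T κ} :=
    le_csInf ⟨_, h1⟩ fun κ hκ => aleph0_le_of_localCharacter.{u, v, w} hinf hκ
  rcases hge.eq_or_lt with h | h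
  · exact Or.inl (congrArg _ h.symm)
  · refine Or.inr (congrArg _ (le_antisymm hle ?_))
    rw [← Cardinal.succ_aleph0]
    exact Order.succ_le_of_lt h

theorem kappaLoc_of_not_isSimple (hT : ¬ IsSimple.{u, v, max u v w} T) :
    kappaLoc.{u, v, max u v w} T = ⊤ :=
  if_neg fun ⟨κ, hκ⟩ => not_localCharacter_of_not_isSimple.{u, v, w} hT κ hκ

end KappaLoc

end LocalForking

theorem mainTheorem11 {L : FirstOrder.Language.{u, v}} (T : L.Theory) (hT : T.IsComplete)
    (hinf : ∃ M : Theory.ModelType.{u, v, max u v w} T, Infinite M) :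
    (LocalForking.kappaLoc.{u, v, max u v w} T = ((ℵ₀ : Cardinal.{max u v w}) : WithTop Cardinal) ∨
      LocalForking.kappaLoc.{u, v, max u v w} T =
        ((Cardinal.aleph 1 : Cardinal.{max u v w}) : WithTop Cardinal) ∨
      LocalForking.kappaLoc.{u, v, max u v w} T = ⊤) ∧
    ((LocalForking.kappaLoc.{u, v, max u v w} T =
          ((ℵ₀ : Cardinal.{max u v w}) : WithTop Cardinal) ∨
        LocalForking.kappaLoc.{u, v, max u v w} T =
          ((Cardinal.aleph 1 : Cardinal.{max u v w}) : WithTop Cardinal)) ↔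
      LocalForking.IsSimple.{u, v, max u v w} T) ∧
    (LocalForking.kappaLoc.{u, v, max u v w} T = ⊤ ↔
      ¬ LocalForking.IsSimple.{u, v, max u v w} T) := by
  by_cases hs : LocalForking.IsSimple.{u, v, max u v w} T
  · have h := LocalForking.kappaLoc_of_isSimple.{u, v, w} hinf hs
    have htop : LocalForking.kappaLoc.{u, v, max u v w} T ≠ ⊤ := by
      rcases h with h | h <;> rw [h] <;> exact WithTop.coe_ne_top
    exact ⟨h.imp_right Or.inl, iff_of_true h hs, iff_of_false htop (not_not.2 hs)⟩
  · have h := LocalForking.kappaLoc_of_not_isSimple.{u, v, w} hs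
    refine ⟨Or.inr (Or.inr h), iff_of_false ?_ hs, iff_of_true h hs⟩
    rw [h]
    rintro (h | h) <;> exact WithTop.coe_ne_top h.symm
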